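/- **Definitions.** Let $k$ be a field and let $\mathcal C$ be a symmetric monoidal $k$-linear Grothendieck abelian category whose tensor product is $k$-bilinear and preserves epimorphisms in each variable (for example, right exact). Let $A$ be a commutative algebra object in $\mathcal C$. The length of an object is the supremum, in $\mathbf N\cup\{\infty\}$, of the lengths of chains of its subobjects. For a subobject $V\subset A$, let $\mathrm{Sym}^i(V)$ be the coinvariants of the symmetric group $\mathfrak S_i$ on $V^{\otimes i}$. Say that $V$ generates $A$ if the canonical map $\bigoplus_{i\ge 0}\mathrm{Sym}^i(V)\to A$ is an epimorphism. Let $f_{A;V}(n)$ be the length of the image of $\bigoplus_{i\le n}\mathrm{Sym}^i(V)\to A$. Let $E(A;V)$ be the set of real numbers $r$ for which there is a real number $c$ with $f_{A;V}(n)\le c\,n^r$ for all $n\ge 1$. Put $\dim(A;V)=\inf E(A;V)$, with $\dim(A;V)=\infty$ if $E(A;V)$ is empty. **(1)** Let $V$ and $W$ be two subobjects of $A$ of finite length that generate $A$. Then $E(A;V)=E(A;W)$; in particular $\dim(A;V)=\dim(A;W)$. Hence the categorical Gelfand–Kirillov dimension $\mathrm{GKdim}(A):=\dim(A;V)$, where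 $V\subset A$ is any generating subobject of finite length, is well defined. **(2)** Assume that $k$ has characteristic $0$. Let $W$ be a $k$-vector space of finite dimension $n$ (for example $W=\mathbf C^n$ over $k=\mathbf C$). Consider the tensor algebra $T(W)=\bigoplus_m W^{\otimes m}$ as a twisted commutative algebra, that is, as a commutative algebra object in the category $\mathrm{Rep}(\mathfrak S_*)$ of sequences $(V_m)_{m\ge 0}$ of $k$-linear representations of the symmetric groups $\mathfrak S_m$, with the product $$(V\boxtimes V')_m=\bigoplus_{i+j=m}\mathrm{Ind}_{\mathfrak S_i\times\mathfrak S_j}^{\mathfrak S_m}(V_i\otimes V'_j);$$ here $\mathfrak S_m$ permutes the factors of $W^{\otimes m}$ and the multiplication is the concatenation of tensors. Then $T(W)$ has a generating subobject of finite length, and $$\mathrm{GKdim}(T(W))=\binom{n+1}{2}.$$ Moreover, for each such generating subobject $V$, the number $\binom{n+1}{2}$ is the smallest element of $E(T(W);V)$. -/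

import Mathlib

open CategoryTheory MonoidalCategory Limits

universe w v₁ v₂ u₁ u₂

section GelfandKirillov

noncomputable section

variable {C : Type u₁} [Category.{v₁} C]

/-- The length of an object of an abelian category: the supremum of the lengths `n` of the chains
`S₀ < S₁ < ⋯ < Sₙ` of its subobjects. -/
def objLength (X : C) : ℕ∞ := Order.height (⊤ : Subobject X)

variable [MonoidalCategory C]

/-- The tensor power `V ⊗ ⋯ ⊗ V`, bracketed to the left. -/
def tensorPow (V : C) : ℕ → C
  | 0 => 𝟙_ C
  | n + 1 => tensorPow V n ⊗ V

/-- For `j + 2 ≤ n`, the action on the `n`-th tensor power of the transposition of the two adjacent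
factors that have exactly `j` factors to their right; the identity for the other `j`. -/
def adjSwap [BraidedCategory C] (V : C) : (n : ℕ) → ℕ → (tensorPow V n ⟶ tensorPow V n)
  | 0, _ => 𝟙 _
  | 1, _ => 𝟙 _
  | n + 2, 0 => (α_ (tensorPow V n) V V).hom ≫ tensorPow V n ◁ (β_ V V).hom ≫
      (α_ (tensorPow V n) V V).inv
  | n + 2, j + 1 => adjSwap V (n + 1) j ▷ V

/-- The symmetric power: the coinvariants of the symmetric group, which is generated by the adjacent
transpositions, on the tensor power. -/
def symPow [Abelian C] [BraidedCategory C] (V : C) (n : ℕ) : C :=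
  cokernel (Sigma.desc fun j : Fin n => adjSwap V n j - 𝟙 (tensorPow V n))

/-- The map from the `n`-th tensor power of `V` to an algebra `A` given by a map `V ⟶ A` and the
multiplication of `A`. -/
def powToAlg {V A : C} [MonObj A] (v : V ⟶ A) : (n : ℕ) → (tensorPow V n ⟶ A)
  | 0 => MonObj.one
  | n + 1 => (powToAlg v n ⊗ₘ v) ≫ MonObj.mul

theorem adjSwap_powToAlg [BraidedCategory C] {V A : C} [MonObj A] [IsCommMonObj A] (v : V ⟶ A) :
    ∀ n j : ℕ, adjSwap V n j ≫ powToAlg v n = powToAlg v n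
  | 0, _ => Category.id_comp _
  | 1, _ => Category.id_comp _
  | n + 2, 0 => by
    have key : powToAlg v (n + 2) = (α_ (tensorPow V n) V V).hom ≫
        (powToAlg v n ⊗ₘ ((v ⊗ₘ v) ≫ MonObj.mul)) ≫ MonObj.mul := by
      change (((powToAlg v n ⊗ₘ v) ≫ MonObj.mul) ⊗ₘ v) ≫ MonObj.mul = _
      have h₁ : ((powToAlg v n ⊗ₘ v) ≫ MonObj.mul) ⊗ₘ v =
          ((powToAlg v n ⊗ₘ v) ⊗ₘ v) ≫ MonObj.mul ▷ A := by
        rw [← tensorHom_id, tensorHom_comp_tensorHom, Category.comp_id]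
      have h₂ : powToAlg v n ⊗ₘ ((v ⊗ₘ v) ≫ MonObj.mul) =
          (powToAlg v n ⊗ₘ (v ⊗ₘ v)) ≫ A ◁ MonObj.mul := by
        rw [← id_tensorHom, tensorHom_comp_tensorHom, Category.comp_id]
      rw [h₁, h₂, Category.assoc, MonObj.mul_assoc, associator_naturality_assoc, Category.assoc]
    have h₃ : (β_ V V).hom ≫ (v ⊗ₘ v) ≫ MonObj.mul = (v ⊗ₘ v) ≫ MonObj.mul := by
      rw [← BraidedCategory.braiding_naturality_assoc, IsCommMonObj.mul_comm]
    rw [key]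
    change ((α_ (tensorPow V n) V V).hom ≫ tensorPow V n ◁ (β_ V V).hom ≫
      (α_ (tensorPow V n) V V).inv) ≫ _ = _
    rw [Category.assoc, Category.assoc, Iso.inv_hom_id_assoc, ← id_tensorHom,
      tensorHom_comp_tensorHom_assoc, Category.id_comp, h₃]
  | n + 2, j + 1 => by
    have h := adjSwap_powToAlg v (n + 1) j
    change adjSwap V (n + 1) j ▷ V ≫ (powToAlg v (n + 1) ⊗ₘ v) ≫ MonObj.mul =
      (powToAlg v (n + 1) ⊗ₘ v) ≫ MonObj.mul
    rw [← Category.assoc, ← tensorHom_id, tensorHom_comp_tensorHom, h, Category.id_comp]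

variable [Abelian C] [BraidedCategory C] {A : C} [MonObj A] [IsCommMonObj A]

/-- The canonical map from the symmetric power of `V` to a commutative algebra `A`. -/
def symToAlg {V : C} (v : V ⟶ A) (n : ℕ) : symPow V n ⟶ A :=
  cokernel.desc _ (powToAlg v n) (by
    apply Sigma.hom_ext
    intro j
    simp [Preadditive.sub_comp, adjSwap_powToAlg])

/-- The image `A_{V, ≤ n}` of the canonical map from the direct sum of the symmetric powers
`Sym^i(V)`, `i ≤ n`, to `A`. -/
def genFiltration (V : Subobject A) (n : ℕ) : Subobject A :=
  imageSubobject (Sigma.desc fun i : Fin (n + 1) => symToAlg V.arrow i)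

/-- The subobject `V` generates the commutative algebra `A`: the maps `Sym^i(V) ⟶ A` are jointly
epimorphic, i.e. the canonical map from their direct sum `Sym(V)` to `A` is an epimorphism. -/
def Generates (V : Subobject A) : Prop :=
  ∀ ⦃Z : C⦄ (f g : A ⟶ Z), (∀ i, symToAlg V.arrow i ≫ f = symToAlg V.arrow i ≫ g) → f = g

/-- `V` has finite length and generates `A`. -/
def IsFiniteLengthGenerating (V : Subobject A) : Prop :=
  objLength (V : C) ≠ ⊤ ∧ Generates V

/-- The growth function `f_{A; V}`: the length of `A_{V, ≤ n}`. -/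
def growth (V : Subobject A) (n : ℕ) : ℕ∞ := objLength (genFiltration V n : C)

/-- The real numbers `r` for which there is a real constant `c` with `f_{A; V}(n) ≤ c n ^ r` for all
`n ≥ 1`. -/
def growthExponents (V : Subobject A) : Set ℝ :=
  {r | ∃ c : ℝ, ∀ n : ℕ, 1 ≤ n → (growth V n : ENNReal) ≤ ENNReal.ofReal (c * (n : ℝ) ^ r)}

/-- The categorical Gelfand-Kirillov dimension `dim(A; V)` of `A` with respect to `V`, the infimum of
the exponents above; it is `⊤` if there are none. -/
def gkDimWrt (V : Subobject A) : EReal := ⨅ r ∈ growthExponents V, (r : EReal)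

variable (A) in
/-- The categorical Gelfand-Kirillov dimension of `A`: the value of `dim(A; V)` on the generating
subobjects `V` of finite length (these values are all the same). -/
def gkDim : EReal := ⨅ (V : Subobject A) (_ : IsFiniteLengthGenerating V), gkDimWrt V

end

end GelfandKirillov

/-- The groupoid of the finite sets `Fin n`, `n ∈ ℕ`, and their bijections. There are no morphisms
between `m` and `n` for `m ≠ n`, and the automorphism group of `n` is the symmetric group on
`n` letters. -/
structure FinBij : Type where
  card : ℕ

namespace FinBij

instance : Category FinBij where
  Hom m n := Fin m.card ≃ Fin n.card
  id m := Equiv.refl _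
  comp f g := f.trans g

/-- A bijection, as an isomorphism. -/
def isoOfEquiv {m n : FinBij} (e : Fin m.card ≃ Fin n.card) : m ≅ n where
  hom := e
  inv := e.symm
  hom_inv_id := e.self_trans_symm
  inv_hom_id := e.symm_trans_self

/-- Block sum of bijections: the standard embedding of a product of two symmetric groups. -/
def sumHom {a b c d : ℕ} (f : Fin a ≃ Fin b) (g : Fin c ≃ Fin d) : Fin (a + c) ≃ Fin (b + d) :=
  finSumFinEquiv.symm.trans ((Equiv.sumCongr f g).trans finSumFinEquiv)

/-- The permutation that interchanges a block of `a` letters and a block of `b` letters. -/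
def swapBlocks (a b : ℕ) : Fin (a + b) ≃ Fin (b + a) :=
  finSumFinEquiv.symm.trans ((Equiv.sumComm _ _).trans finSumFinEquiv)

@[simp] theorem sumHom_castAdd {a b c d : ℕ} (f : Fin a ≃ Fin b) (g : Fin c ≃ Fin d) (i : Fin a) :
    sumHom f g (Fin.castAdd c i) = Fin.castAdd d (f i) := by simp [sumHom]
@[simp] theorem sumHom_natAdd {a b c d : ℕ} (f : Fin a ≃ Fin b) (g : Fin c ≃ Fin d) (i : Fin c) :
    sumHom f g (Fin.natAdd a i) = Fin.natAdd b (g i) := by simp [sumHom]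
@[simp] theorem swapBlocks_castAdd (a b : ℕ) (i : Fin a) :
    swapBlocks a b (Fin.castAdd b i) = Fin.natAdd b i := by simp [swapBlocks]
@[simp] theorem swapBlocks_natAdd (a b : ℕ) (i : Fin b) :
    swapBlocks a b (Fin.natAdd a i) = Fin.castAdd a i := by simp [swapBlocks]


/-- Reassociation of blocks. -/
def assocBlocks (a b c : ℕ) : Fin (a + b + c) ≃ Fin (a + (b + c)) :=
  finCongr (Nat.add_assoc a b c)

@[simp] theorem assocBlocks_left (a b c : ℕ) (i : Fin a) :
    assocBlocks a b c (Fin.castAdd c (Fin.castAdd b i)) = Fin.castAdd (b + c) i := rfl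

@[simp] theorem assocBlocks_mid (a b c : ℕ) (i : Fin b) :
    assocBlocks a b c (Fin.castAdd c (Fin.natAdd a i)) = Fin.natAdd a (Fin.castAdd c i) := rfl

@[simp] theorem assocBlocks_right (a b c : ℕ) (i : Fin c) :
    assocBlocks a b c (Fin.natAdd (a + b) i) = Fin.natAdd a (Fin.natAdd b i) :=
  Fin.ext (Nat.add_assoc a b i)

/-- Dropping an empty block on the left. -/
def zeroBlock (a : ℕ) : Fin (0 + a) ≃ Fin a := finCongr (Nat.zero_add a)

@[simp] theorem zeroBlock_natAdd (a : ℕ) (i : Fin a) : zeroBlock a (Fin.natAdd 0 i) = i :=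
  Fin.ext (Nat.zero_add i)

/-- Dropping an empty block on the right. -/
def zeroBlockRight (a : ℕ) : Fin (a + 0) ≃ Fin a := finCongr (Nat.add_zero a)

@[simp] theorem zeroBlockRight_castAdd (a : ℕ) (i : Fin a) :
    zeroBlockRight a (Fin.castAdd 0 i) = i := rfl

@[simp] theorem assocBlocks_symm_left (a b c : ℕ) (i : Fin a) :
    (assocBlocks a b c).symm (Fin.castAdd (b + c) i) = Fin.castAdd c (Fin.castAdd b i) := rfl

@[simp] theorem assocBlocks_symm_mid (a b c : ℕ) (i : Fin b) :
    (assocBlocks a b c).symm (Fin.natAdd a (Fin.castAdd c i)) =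
      Fin.castAdd c (Fin.natAdd a i) := rfl

@[simp] theorem assocBlocks_symm_right (a b c : ℕ) (i : Fin c) :
    (assocBlocks a b c).symm (Fin.natAdd a (Fin.natAdd b i)) = Fin.natAdd (a + b) i :=
  Fin.ext (Nat.add_assoc a b i).symm

theorem equiv_ext_add {a b n : ℕ} {f g : Fin (a + b) ≃ Fin n}
    (h₁ : ∀ i, f (Fin.castAdd b i) = g (Fin.castAdd b i))
    (h₂ : ∀ i, f (Fin.natAdd a i) = g (Fin.natAdd a i)) : f = g :=
  Equiv.ext fun i => Fin.addCases h₁ h₂ i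

theorem sumHom_trans {a b c d e f : ℕ} (p : Fin a ≃ Fin b) (q : Fin c ≃ Fin d)
    (r : Fin b ≃ Fin e) (s : Fin d ≃ Fin f) :
    (sumHom p q).trans (sumHom r s) = sumHom (p.trans r) (q.trans s) := by
  apply equiv_ext_add <;> simp

theorem sumHom_refl (a b : ℕ) :
    sumHom (Equiv.refl (Fin a)) (Equiv.refl (Fin b)) = Equiv.refl (Fin (a + b)) := by
  apply equiv_ext_add <;> simp

theorem assocBlocks_naturality {a b c a' b' c' : ℕ} (p : Fin a ≃ Fin a') (q : Fin b ≃ Fin b')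
    (r : Fin c ≃ Fin c') :
    (sumHom (sumHom p q) r).trans (assocBlocks a' b' c') =
      (assocBlocks a b c).trans (sumHom p (sumHom q r)) := by
  refine equiv_ext_add (fun i => ?_) (fun i => by simp)
  induction i using Fin.addCases <;> simp

theorem pentagon_aux (a b c d : ℕ) :
    (sumHom (assocBlocks a b c) (Equiv.refl (Fin d))).trans
        ((assocBlocks a (b + c) d).trans (sumHom (Equiv.refl (Fin a)) (assocBlocks b c d))) =
      (assocBlocks (a + b) c d).trans (assocBlocks a b (c + d)) := by
  refine equiv_ext_add (fun i => ?_) (fun i => by simp)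
  induction i using Fin.addCases with
  | left i => induction i using Fin.addCases <;> simp
  | right i => simp

theorem hexagon_aux (a b c : ℕ) :
    (assocBlocks a b c).trans ((swapBlocks a (b + c)).trans (assocBlocks b c a)) =
      (sumHom (swapBlocks a b) (Equiv.refl (Fin c))).trans
        ((assocBlocks b a c).trans (sumHom (Equiv.refl (Fin b)) (swapBlocks a c))) := by
  refine equiv_ext_add (fun i => ?_) (fun i => by simp)
  induction i using Fin.addCases <;> simp

theorem hexagon_reverse_aux (a b c : ℕ) :
    (assocBlocks a b c).symm.trans ((swapBlocks (a + b) c).trans (assocBlocks c a b).symm) =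
      (sumHom (Equiv.refl (Fin a)) (swapBlocks b c)).trans
        ((assocBlocks a c b).symm.trans (sumHom (swapBlocks a c) (Equiv.refl (Fin b)))) := by
  refine equiv_ext_add (fun i => by simp) (fun i => ?_)
  induction i using Fin.addCases <;> simp

theorem triangle_aux (a b : ℕ) :
    (assocBlocks a 0 b).trans (sumHom (Equiv.refl (Fin a)) (zeroBlock b)) =
      sumHom (zeroBlockRight a) (Equiv.refl (Fin b)) := by
  refine equiv_ext_add (fun i => ?_) (fun i => ?_)
  · induction i using Fin.addCases with
    | left i =>
      rw [Equiv.trans_apply, assocBlocks_left, sumHom_castAdd, sumHom_castAdd,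
        zeroBlockRight_castAdd]
      rfl
    | right i => exact i.elim0
  · rw [Equiv.trans_apply, assocBlocks_right, sumHom_natAdd, sumHom_natAdd, zeroBlock_natAdd]
    rfl

theorem swapBlocks_naturality {a b a' b' : ℕ} (p : Fin a ≃ Fin a') (q : Fin b ≃ Fin b') :
    (sumHom p q).trans (swapBlocks a' b') = (swapBlocks a b).trans (sumHom q p) := by
  apply equiv_ext_add <;> simp

theorem swapBlocks_symm (a b : ℕ) : (swapBlocks a b).trans (swapBlocks b a) = Equiv.refl _ := by
  apply equiv_ext_add <;> simp

instance : MonoidalCategoryStruct FinBij where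
  tensorObj m n := ⟨m.card + n.card⟩
  tensorHom f g := sumHom f g
  whiskerLeft m _ _ g := sumHom (Equiv.refl (Fin m.card)) g
  whiskerRight f n := sumHom f (Equiv.refl (Fin n.card))
  tensorUnit := ⟨0⟩
  associator a b c := isoOfEquiv (assocBlocks a.card b.card c.card)
  leftUnitor a := isoOfEquiv (zeroBlock a.card)
  rightUnitor a := isoOfEquiv (zeroBlockRight a.card)

instance : MonoidalCategory FinBij :=
  MonoidalCategory.ofTensorHom
    (id_tensorHom_id := fun a b => sumHom_refl a.card b.card)
    (tensorHom_comp_tensorHom := fun p q r s => sumHom_trans p q r s)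
    (associator_naturality := fun p q r => assocBlocks_naturality p q r)
    (leftUnitor_naturality := fun {a b} f => by
      refine equiv_ext_add (a := 0) (b := a.card) (n := b.card) (fun i => i.elim0) (fun i => ?_)
      change zeroBlock b.card (sumHom (Equiv.refl (Fin 0)) f (Fin.natAdd 0 i)) =
        (show Fin a.card ≃ Fin b.card from f) (zeroBlock a.card (Fin.natAdd 0 i))
      rw [sumHom_natAdd, zeroBlock_natAdd, zeroBlock_natAdd])
    (rightUnitor_naturality := fun {a b} f => by
      refine equiv_ext_add (a := a.card) (b := 0) (n := b.card) (fun i => ?_) (fun i => i.elim0)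
      change zeroBlockRight b.card (sumHom f (Equiv.refl (Fin 0)) (Fin.castAdd 0 i)) =
        (show Fin a.card ≃ Fin b.card from f) (zeroBlockRight a.card (Fin.castAdd 0 i))
      rw [sumHom_castAdd, zeroBlockRight_castAdd, zeroBlockRight_castAdd])
    (pentagon := fun a b c d => pentagon_aux a.card b.card c.card d.card)
    (triangle := fun a b => triangle_aux a.card b.card)

instance : SymmetricCategory FinBij where
  braiding a b := isoOfEquiv (swapBlocks a.card b.card)
  braiding_naturality_right a _ _ f :=
    swapBlocks_naturality (Equiv.refl (Fin a.card)) f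
  braiding_naturality_left f a :=
    swapBlocks_naturality f (Equiv.refl (Fin a.card))
  hexagon_forward a b c := hexagon_aux a.card b.card c.card
  hexagon_reverse a b c := hexagon_reverse_aux a.card b.card c.card
  symmetry a b := swapBlocks_symm a.card b.card

end FinBij

namespace DaySymm

noncomputable section
open scoped CategoryTheory.MonoidalCategory.DayConvolution
open CategoryTheory.MonoidalCategory.LawfulDayConvolutionMonoidalCategoryStruct
open scoped CategoryTheory.MonoidalCategory.ExternalProduct

variable {C : Type u₁} [Category.{v₁} C] {V : Type u₂} [Category.{v₂} V]
    [MonoidalCategory C] [MonoidalCategory V]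
    [hasDayConvolution : ∀ (F G : C ⥤ V),
      (tensor C).HasPointwiseLeftKanExtension (F ⊠ G)]
    [hasDayConvolutionUnit :
      (Functor.fromPUnit.{0} <| 𝟙_ C).HasPointwiseLeftKanExtension
        (Functor.fromPUnit.{0} <| 𝟙_ V)]
    [∀ (v : V) (d : C), Limits.PreservesColimitsOfShape
      (CostructuredArrow (tensor C) d) (tensorLeft v)]
    [∀ (v : V) (d : C), Limits.PreservesColimitsOfShape
      (CostructuredArrow (tensor C) d) (tensorRight v)]
    [∀ (v : V) (d : C), Limits.PreservesColimitsOfShape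
      (CostructuredArrow (Functor.fromPUnit.{0} <| 𝟙_ C) d) (tensorLeft v)]
    [∀ (v : V) (d : C), Limits.PreservesColimitsOfShape
      (CostructuredArrow (Functor.fromPUnit.{0} <| 𝟙_ C) d) (tensorRight v)]
    [∀ (v : V) (d : C × C),
      Limits.PreservesColimitsOfShape
        (CostructuredArrow ((𝟭 C).prod <| Functor.fromPUnit.{0} <| 𝟙_ C) d)
        (tensorRight v)]
    [∀ (v : V) (d : C × C),
      Limits.PreservesColimitsOfShape
        (CostructuredArrow ((tensor C).prod (𝟭 C)) d) (tensorRight v)]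

attribute [local instance] convolution convolution₂ convolution₂'

theorem ι_map_assoc_inv (F G H : DayFunctor C V) :
    (ι C V (DayFunctor C V)).map (α_ F G H).inv =
      (DayConvolution.associator ((ι C V (DayFunctor C V)).obj F)
        ((ι C V (DayFunctor C V)).obj G) ((ι C V (DayFunctor C V)).obj H)).inv := by
  rw [← cancel_epi ((ι C V (DayFunctor C V)).map (α_ F G H).hom), ← CategoryTheory.Functor.map_comp,
    Iso.hom_inv_id, CategoryTheory.Functor.map_id, ι_map_associator_hom_eq_associator_hom]
  exact (Iso.hom_inv_id _).symm

theorem tensor_hom_ext₃ {F G H K : DayFunctor C V} {f g : (F ⊗ G) ⊗ H ⟶ K}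
    (h : ∀ x y z : C,
      (DayFunctor.η F G).app (x, y) ▷ H.functor.obj z ≫
          (DayFunctor.η (F ⊗ G) H).app (x ⊗ y, z) ≫ f.natTrans.app ((x ⊗ y) ⊗ z) =
        (DayFunctor.η F G).app (x, y) ▷ H.functor.obj z ≫
          (DayFunctor.η (F ⊗ G) H).app (x ⊗ y, z) ≫ g.natTrans.app ((x ⊗ y) ⊗ z)) : f = g := by
  apply DayFunctor.hom_ext
  apply Functor.hom_ext_of_isLeftKanExtension ((F ⊗ G) ⊗ H).functor (DayFunctor.η (F ⊗ G) H)
  have inst : ((F ⊗ G).functor ⊠ H.functor).IsLeftKanExtension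
      (ExternalProduct.extensionUnitLeft (F ⊗ G).functor (DayFunctor.η F G) H.functor) :=
    (ExternalProduct.isPointwiseLeftKanExtensionExtensionUnitLeft _ _ _
      (isPointwiseLeftKanExtensionConvolutionExtensionUnit F G)).isLeftKanExtension
  apply Functor.hom_ext_of_isLeftKanExtension ((F ⊗ G).functor ⊠ H.functor)
    (ExternalProduct.extensionUnitLeft (F ⊗ G).functor (DayFunctor.η F G) H.functor)
  apply NatTrans.ext
  funext ⟨⟨x, y⟩, z⟩
  have := h x y z
  simp
  exact this

theorem unit_tensor_hom_ext {F K : DayFunctor C V} {f g : 𝟙_ (DayFunctor C V) ⊗ F ⟶ K}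
    (h : ∀ x : C,
      DayFunctor.ν C V ▷ F.functor.obj x ≫
          (DayFunctor.η (𝟙_ (DayFunctor C V)) F).app (𝟙_ C, x) ≫ f.natTrans.app (𝟙_ C ⊗ x) =
        DayFunctor.ν C V ▷ F.functor.obj x ≫
          (DayFunctor.η (𝟙_ (DayFunctor C V)) F).app (𝟙_ C, x) ≫ g.natTrans.app (𝟙_ C ⊗ x)) :
    f = g := by
  apply DayFunctor.hom_ext
  apply Functor.hom_ext_of_isLeftKanExtension (𝟙_ (DayFunctor C V) ⊗ F).functor
    (DayFunctor.η (𝟙_ (DayFunctor C V)) F)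
  have inst : ((𝟙_ (DayFunctor C V)).functor ⊠ F.functor).IsLeftKanExtension
      (ExternalProduct.extensionUnitLeft (𝟙_ (DayFunctor C V)).functor
        (DayFunctor.νNatTrans C V) F.functor) :=
    (ExternalProduct.isPointwiseLeftKanExtensionExtensionUnitLeft _ _ _
      (isPointwiseLeftKanExtensionUnitUnit C V (DayFunctor C V))).isLeftKanExtension
  apply Functor.hom_ext_of_isLeftKanExtension ((𝟙_ (DayFunctor C V)).functor ⊠ F.functor)
    (ExternalProduct.extensionUnitLeft (𝟙_ (DayFunctor C V)).functor
        (DayFunctor.νNatTrans C V) F.functor)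
  apply NatTrans.ext
  funext ⟨_, x⟩
  have := h x
  simp
  exact this

theorem tensor_unit_hom_ext {F K : DayFunctor C V} {f g : F ⊗ 𝟙_ (DayFunctor C V) ⟶ K}
    (h : ∀ x : C,
      F.functor.obj x ◁ DayFunctor.ν C V ≫
          (DayFunctor.η F (𝟙_ (DayFunctor C V))).app (x, 𝟙_ C) ≫ f.natTrans.app (x ⊗ 𝟙_ C) =
        F.functor.obj x ◁ DayFunctor.ν C V ≫
          (DayFunctor.η F (𝟙_ (DayFunctor C V))).app (x, 𝟙_ C) ≫ g.natTrans.app (x ⊗ 𝟙_ C)) :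
    f = g := by
  apply DayFunctor.hom_ext
  apply Functor.hom_ext_of_isLeftKanExtension (F ⊗ 𝟙_ (DayFunctor C V)).functor
    (DayFunctor.η F (𝟙_ (DayFunctor C V)))
  have inst : (F.functor ⊠ (𝟙_ (DayFunctor C V)).functor).IsLeftKanExtension
      (ExternalProduct.extensionUnitRight (𝟙_ (DayFunctor C V)).functor
        (DayFunctor.νNatTrans C V) F.functor) :=
    (ExternalProduct.isPointwiseLeftKanExtensionExtensionUnitRight _ _ _
      (isPointwiseLeftKanExtensionUnitUnit C V (DayFunctor C V))).isLeftKanExtension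
  apply Functor.hom_ext_of_isLeftKanExtension (F.functor ⊠ (𝟙_ (DayFunctor C V)).functor)
    (ExternalProduct.extensionUnitRight (𝟙_ (DayFunctor C V)).functor
        (DayFunctor.νNatTrans C V) F.functor)
  apply NatTrans.ext
  funext ⟨x, _⟩
  have := h x
  simp
  exact this

theorem η_whiskerRight {F G : DayFunctor C V} (f : F ⟶ G) (H : DayFunctor C V) (x y : C) :
    (DayFunctor.η F H).app (x, y) ≫ (f ▷ H).natTrans.app (x ⊗ y) =
      f.natTrans.app x ▷ H.functor.obj y ≫ (DayFunctor.η G H).app (x, y) :=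
  convolutionExtensionUnit_comp_ι_map_whiskerRight_app C V f H x y

theorem η_whiskerLeft (H : DayFunctor C V) {F G : DayFunctor C V} (f : F ⟶ G) (x y : C) :
    (DayFunctor.η H F).app (x, y) ≫ (H ◁ f).natTrans.app (x ⊗ y) =
      H.functor.obj x ◁ f.natTrans.app y ≫ (DayFunctor.η H G).app (x, y) :=
  convolutionExtensionUnit_comp_ι_map_whiskerLeft_app V H f x y

theorem η_associator (F G H : DayFunctor C V) (x y z : C) :
    (DayFunctor.η F G).app (x, y) ▷ H.functor.obj z ≫ (DayFunctor.η (F ⊗ G) H).app (x ⊗ y, z) ≫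
        (α_ F G H).hom.natTrans.app ((x ⊗ y) ⊗ z) =
      (α_ _ _ _).hom ≫ F.functor.obj x ◁ (DayFunctor.η G H).app (y, z) ≫
        (DayFunctor.η F (G ⊗ H)).app (x, y ⊗ z) ≫
          (F ⊗ G ⊗ H).functor.map (α_ x y z).inv :=
  associator_hom_unit_unit V F G H x y z

theorem η_leftUnitor (F : DayFunctor C V) (x : C) :
    DayFunctor.ν C V ▷ F.functor.obj x ≫ (DayFunctor.η (𝟙_ (DayFunctor C V)) F).app (𝟙_ C, x) ≫
        (λ_ F).hom.natTrans.app (𝟙_ C ⊗ x) =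
      (λ_ (F.functor.obj x)).hom ≫ F.functor.map (λ_ x).inv :=
  leftUnitor_hom_unit_app V F x

theorem η_rightUnitor (F : DayFunctor C V) (x : C) :
    F.functor.obj x ◁ DayFunctor.ν C V ≫ (DayFunctor.η F (𝟙_ (DayFunctor C V))).app (x, 𝟙_ C) ≫
        (ρ_ F).hom.natTrans.app (x ⊗ 𝟙_ C) =
      (ρ_ (F.functor.obj x)).hom ≫ F.functor.map (ρ_ x).inv :=
  rightUnitor_hom_unit_app V F x

variable (F : C ⥤ V)

/-- The multiplication on a lax monoidal functor, as a map out of a Day convolution. -/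
def laxMul [F.LaxMonoidal] :
    (DayFunctor.mk F : DayFunctor C V) ⊗ DayFunctor.mk F ⟶ DayFunctor.mk F :=
  DayFunctor.tensorDesc
    { app := fun p => Functor.LaxMonoidal.μ F p.1 p.2
      naturality := fun p q f => by
        simp [MonoidalCategory.tensorHom_def] }

theorem η_laxMul [F.LaxMonoidal] (x y : C) :
    (DayFunctor.η (DayFunctor.mk F) (DayFunctor.mk F)).app (x, y) ≫
      (laxMul F).natTrans.app (x ⊗ y) = Functor.LaxMonoidal.μ F x y :=
  DayFunctor.η_comp_tensorDesc_app _ x y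

/-- A lax monoidal functor is a monoid object for the Day convolution. -/
instance laxMonObj [F.LaxMonoidal] : MonObj (DayFunctor.mk F : DayFunctor C V) where
  one := DayFunctor.unitDesc (Functor.LaxMonoidal.ε F)
  mul := laxMul F
  one_mul := by
    apply unit_tensor_hom_ext
    intro x
    have h₁ : DayFunctor.ν C V ≫ (DayFunctor.unitDesc (F := DayFunctor.mk F)
        (Functor.LaxMonoidal.ε F)).natTrans.app (𝟙_ C) = Functor.LaxMonoidal.ε F :=
      DayFunctor.ν_comp_unitDesc _
    have h₂ : Functor.LaxMonoidal.ε F ▷ F.obj x ≫ Functor.LaxMonoidal.μ F (𝟙_ C) x =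
        (λ_ (F.obj x)).hom ≫ F.map (λ_ x).inv := by
      rw [Functor.LaxMonoidal.left_unitality F x]
      simp [← CategoryTheory.Functor.map_comp]
    rw [η_leftUnitor, DayFunctor.comp_natTrans, NatTrans.comp_app, reassoc_of% η_whiskerRight,
      η_laxMul, ← comp_whiskerRight_assoc]
    exact (congrArg (fun t => t ▷ F.obj x ≫ Functor.LaxMonoidal.μ F (𝟙_ C) x) h₁).trans h₂
  mul_one := by
    apply tensor_unit_hom_ext
    intro x
    have h₁ : DayFunctor.ν C V ≫ (DayFunctor.unitDesc (F := DayFunctor.mk F)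
        (Functor.LaxMonoidal.ε F)).natTrans.app (𝟙_ C) = Functor.LaxMonoidal.ε F :=
      DayFunctor.ν_comp_unitDesc _
    have h₂ : F.obj x ◁ Functor.LaxMonoidal.ε F ≫ Functor.LaxMonoidal.μ F x (𝟙_ C) =
        (ρ_ (F.obj x)).hom ≫ F.map (ρ_ x).inv := by
      rw [Functor.LaxMonoidal.right_unitality F x]
      simp [← CategoryTheory.Functor.map_comp]
    rw [η_rightUnitor, DayFunctor.comp_natTrans, NatTrans.comp_app, reassoc_of% η_whiskerLeft,
      η_laxMul, ← whiskerLeft_comp_assoc]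
    exact (congrArg (fun t => F.obj x ◁ t ≫ Functor.LaxMonoidal.μ F x (𝟙_ C)) h₁).trans h₂
  mul_assoc := by
    apply tensor_hom_ext₃
    intro x y z
    simp only [DayFunctor.comp_natTrans, NatTrans.comp_app]
    rw [reassoc_of% η_whiskerRight, η_laxMul, ← comp_whiskerRight_assoc, η_laxMul,
      reassoc_of% η_associator, NatTrans.naturality_assoc, NatTrans.naturality]
    simp only [tensor_obj]
    rw [reassoc_of% η_whiskerLeft, reassoc_of% η_laxMul, ← whiskerLeft_comp_assoc, η_laxMul]
    have := Functor.LaxMonoidal.associativity F x y z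
    rw [← cancel_mono (F.map (α_ x y z).hom)]
    simp [this, ← CategoryTheory.Functor.map_comp]

section Symmetric

variable [SymmetricCategory C] [SymmetricCategory V]

/-- The braiding of the Day convolution. -/
def braid (F G : DayFunctor C V) : F ⊗ G ≅ G ⊗ F where
  hom := ⟨(DayConvolution.braiding ((ι C V (DayFunctor C V)).obj F)
    ((ι C V (DayFunctor C V)).obj G)).hom⟩
  inv := ⟨(DayConvolution.braiding ((ι C V (DayFunctor C V)).obj F)
    ((ι C V (DayFunctor C V)).obj G)).inv⟩
  hom_inv_id := DayFunctor.hom_ext (Iso.hom_inv_id _)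
  inv_hom_id := DayFunctor.hom_ext (Iso.inv_hom_id _)

theorem ι_map_braid (F G : DayFunctor C V) :
    (ι C V (DayFunctor C V)).map (braid F G).hom =
      (DayConvolution.braiding ((ι C V (DayFunctor C V)).obj F)
        ((ι C V (DayFunctor C V)).obj G)).hom := by
  rfl

instance : SymmetricCategory (DayFunctor C V) where
  braiding := braid
  braiding_naturality_right F G H f := by
    apply (ι C V (DayFunctor C V)).map_injective
    rw [CategoryTheory.Functor.map_comp, CategoryTheory.Functor.map_comp, ← id_tensorHom, ← tensorHom_id]
    simp only [ι_map_tensorHom_hom_eq_tensorHom, ι_map_braid, CategoryTheory.Functor.map_id]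
    exact DayConvolution.braiding_naturality_right _ _
  braiding_naturality_left f F := by
    apply (ι C V (DayFunctor C V)).map_injective
    rw [CategoryTheory.Functor.map_comp, CategoryTheory.Functor.map_comp, ← id_tensorHom, ← tensorHom_id]
    simp only [ι_map_tensorHom_hom_eq_tensorHom, ι_map_braid, CategoryTheory.Functor.map_id]
    exact DayConvolution.braiding_naturality_left _ _
  hexagon_forward F G H := by
    apply (ι C V (DayFunctor C V)).map_injective
    rw [← id_tensorHom, ← tensorHom_id]
    simp only [CategoryTheory.Functor.map_comp, ι_map_tensorHom_hom_eq_tensorHom, ι_map_braid,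
      CategoryTheory.Functor.map_id, ι_map_associator_hom_eq_associator_hom]
    exact DayConvolution.hexagon_forward _ _ _
  hexagon_reverse F G H := by
    apply (ι C V (DayFunctor C V)).map_injective
    rw [← id_tensorHom, ← tensorHom_id]
    simp only [CategoryTheory.Functor.map_comp, ι_map_tensorHom_hom_eq_tensorHom, ι_map_braid,
      CategoryTheory.Functor.map_id, ι_map_assoc_inv]
    exact DayConvolution.hexagon_reverse _ _ _
  symmetry F G := by
    apply (ι C V (DayFunctor C V)).map_injective
    rw [CategoryTheory.Functor.map_comp, CategoryTheory.Functor.map_id]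
    exact DayConvolution.symmetry _ _

theorem η_braiding (F G : DayFunctor C V) (x y : C) :
    (DayFunctor.η F G).app (x, y) ≫ (β_ F G).hom.natTrans.app (x ⊗ y) =
      (β_ (F.functor.obj x) (G.functor.obj y)).hom ≫ (DayFunctor.η G F).app (y, x) ≫
        (G ⊗ F).functor.map (β_ y x).hom :=
  DayConvolution.unit_app_braiding_hom_app ((ι C V (DayFunctor C V)).obj F)
    ((ι C V (DayFunctor C V)).obj G) x y

/-- A lax symmetric monoidal functor is a commutative monoid object for the Day convolution. -/
instance laxIsCommMonObj [F.LaxBraided] : IsCommMonObj (DayFunctor.mk F : DayFunctor C V) where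
  mul_comm := by
    apply DayFunctor.tensor_hom_ext
    intro x y
    change _ ≫ ((β_ (DayFunctor.mk F) (DayFunctor.mk F)).hom ≫ laxMul F).natTrans.app _ =
      _ ≫ (laxMul F).natTrans.app _
    rw [DayFunctor.comp_natTrans, NatTrans.comp_app]
    simp only [tensor_obj]
    rw [reassoc_of% η_braiding, NatTrans.naturality]
    simp only [tensor_obj]
    rw [reassoc_of% η_laxMul, η_laxMul]
    have := Functor.LaxBraided.braided (F := F) y x
    change _ ≫ _ ≫ F.map (β_ y x).hom = _
    rw [this]
    exact SymmetricCategory.symmetry_assoc _ _ _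

end Symmetric

end

end DaySymm

noncomputable section
open scoped TensorProduct

/-- The category of sequences `(V_n)` of representations of the symmetric groups over `k`, as
functors from the groupoid of finite sets and bijections, with its induction product
`(V ⊠ W)_n = ⨁_{i + j = n} Ind (V_i ⊗ W_j)`, i.e. the Day convolution. The braiding is the one
induced by the braiding of vector spaces and the block permutations. -/
abbrev SymSeq (k : Type u₁) [Field k] := DayFunctor FinBij (ModuleCat.{u₁} k)

namespace SymSeq
variable (k : Type u₁) [Field k]

instance : Preadditive (SymSeq k) where
  homGroup F G := Equiv.addCommGroup (α := F ⟶ G) (β := F.functor ⟶ G.functor)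
    { toFun := fun f => f.natTrans
      invFun := fun f => ⟨f⟩
      left_inv := fun _ => rfl
      right_inv := fun _ => rfl }
  add_comp _ _ _ f g h := DayFunctor.hom_ext (Preadditive.add_comp _ _ _ f.natTrans g.natTrans h.natTrans)
  comp_add _ _ _ f g h := DayFunctor.hom_ext (Preadditive.comp_add _ _ _ f.natTrans g.natTrans h.natTrans)

instance : (DayFunctor.equiv FinBij (ModuleCat.{u₁} k)).functor.Additive where
  map_add := rfl

instance : HasFiniteProducts (SymSeq k) :=
  ⟨fun _ => Adjunction.hasLimitsOfShape_of_equivalence (DayFunctor.equiv FinBij (ModuleCat.{u₁} k)).functor⟩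

instance : Abelian (SymSeq k) := abelianOfEquivalence (DayFunctor.equiv FinBij (ModuleCat.{u₁} k)).functor

variable {S : Type*}

theorem append_sumHom {a b a' b' : ℕ} (σ : Fin a ≃ Fin a') (τ : Fin b ≃ Fin b')
    (v : Fin a → S) (w : Fin b → S) :
    (fun i => Fin.append v w ((FinBij.sumHom σ τ).symm i)) =
      Fin.append (fun i => v (σ.symm i)) (fun i => w (τ.symm i)) := by
  funext i
  obtain ⟨j, rfl⟩ := (FinBij.sumHom σ τ).surjective i
  rw [Equiv.symm_apply_apply]
  induction j using Fin.addCases <;> simp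

theorem append_swapBlocks {a b : ℕ} (v : Fin a → S) (w : Fin b → S) :
    (fun i => Fin.append v w ((FinBij.swapBlocks a b).symm i)) = Fin.append w v := by
  funext i
  obtain ⟨j, rfl⟩ := (FinBij.swapBlocks a b).surjective i
  rw [Equiv.symm_apply_apply]
  induction j using Fin.addCases <;> simp

theorem append_assocBlocks {a b c : ℕ} (u : Fin a → S) (v : Fin b → S) (w : Fin c → S) :
    (fun i => Fin.append (Fin.append u v) w ((FinBij.assocBlocks a b c).symm i)) =
      Fin.append u (Fin.append v w) := by
  funext i
  obtain ⟨j, rfl⟩ := (FinBij.assocBlocks a b c).surjective i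
  rw [Equiv.symm_apply_apply]
  induction j using Fin.addCases with
  | left j => induction j using Fin.addCases <;> simp
  | right j => simp

theorem append_zeroBlock {a : ℕ} (v : Fin 0 → S) (w : Fin a → S) :
    (fun i => Fin.append v w ((FinBij.zeroBlock a).symm i)) = w := by
  funext i
  obtain ⟨j, rfl⟩ := (FinBij.zeroBlock a).surjective i
  rw [Equiv.symm_apply_apply]
  induction j using Fin.addCases with
  | left j => exact j.elim0
  | right j => rw [FinBij.zeroBlock_natAdd, Fin.append_right]

theorem append_zeroBlockRight {a : ℕ} (v : Fin a → S) (w : Fin 0 → S) :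
    (fun i => Fin.append v w ((FinBij.zeroBlockRight a).symm i)) = v := by
  funext i
  obtain ⟨j, rfl⟩ := (FinBij.zeroBlockRight a).surjective i
  rw [Equiv.symm_apply_apply]
  induction j using Fin.addCases with
  | left j => rw [FinBij.zeroBlockRight_castAdd, Fin.append_left]
  | right j => exact j.elim0

variable {k} (W : Type u₁) [AddCommGroup W] [Module k W]


/-- The tensor powers of `W`: the bijection `σ` sends `w₁ ⊗ ⋯ ⊗ wₙ` to
`w_{σ⁻¹(1)} ⊗ ⋯ ⊗ w_{σ⁻¹(n)}`. -/
def tensorFunctor : FinBij ⥤ ModuleCat.{u₁} k where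
  obj n := ModuleCat.of k (⨂[k] (_ : Fin n.card), W)
  map {m n} σ := ModuleCat.ofHom
    (PiTensorProduct.reindex k (fun _ => W) (show Fin m.card ≃ Fin n.card from σ)).toLinearMap
  map_id n := by
    apply ModuleCat.hom_ext
    apply PiTensorProduct.ext
    ext w
    exact PiTensorProduct.reindex_tprod _ _
  map_comp {a b c} f g := by
    apply ModuleCat.hom_ext
    apply PiTensorProduct.ext
    ext w
    change PiTensorProduct.reindex k (fun _ => W) _ (PiTensorProduct.tprod k w) =
      PiTensorProduct.reindex k (fun _ => W) _
        (PiTensorProduct.reindex k (fun _ => W) _ (PiTensorProduct.tprod k w))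
    rw [PiTensorProduct.reindex_tprod, PiTensorProduct.reindex_tprod]
    erw [PiTensorProduct.reindex_tprod]
    rfl

/-- Concatenation of tensors, the multiplication of the tensor algebra. -/
def concat (a b : ℕ) :
    (⨂[k] (_ : Fin a), W) ⊗[k] (⨂[k] (_ : Fin b), W) →ₗ[k] ⨂[k] (_ : Fin (a + b)), W :=
  (PiTensorProduct.reindex k (fun _ => W) finSumFinEquiv).toLinearMap ∘ₗ
    (PiTensorProduct.tmulEquiv k W).toLinearMap

theorem concat_tprod (a b : ℕ) (v : Fin a → W) (w : Fin b → W) :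
    concat W a b (PiTensorProduct.tprod k v ⊗ₜ PiTensorProduct.tprod k w) =
      PiTensorProduct.tprod k (Fin.append v w) := by
  change PiTensorProduct.reindex k (fun _ => W) finSumFinEquiv (PiTensorProduct.tmulEquiv k W
    (PiTensorProduct.tprod k v ⊗ₜ PiTensorProduct.tprod k w)) = _
  rw [PiTensorProduct.tmulEquiv_apply, PiTensorProduct.reindex_tprod]
  congr 1
  funext i
  induction i using Fin.addCases <;> simp

theorem tmul_ext {a b : ℕ} {M : Type*} [AddCommGroup M] [Module k M]
    {f g : (⨂[k] (_ : Fin a), W) ⊗[k] (⨂[k] (_ : Fin b), W) →ₗ[k] M}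
    (h : ∀ v w, f (PiTensorProduct.tprod k v ⊗ₜ PiTensorProduct.tprod k w) =
      g (PiTensorProduct.tprod k v ⊗ₜ PiTensorProduct.tprod k w)) : f = g := by
  apply TensorProduct.ext
  apply PiTensorProduct.ext
  ext v : 1
  apply PiTensorProduct.ext
  ext w
  exact h v w

theorem tmul_ext₃ {a b c : ℕ} {M : Type*} [AddCommGroup M] [Module k M]
    {f g : ((⨂[k] (_ : Fin a), W) ⊗[k] (⨂[k] (_ : Fin b), W)) ⊗[k] (⨂[k] (_ : Fin c), W) →ₗ[k] M}
    (h : ∀ u v w, f ((PiTensorProduct.tprod k u ⊗ₜ PiTensorProduct.tprod k v) ⊗ₜ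
        PiTensorProduct.tprod k w) =
      g ((PiTensorProduct.tprod k u ⊗ₜ PiTensorProduct.tprod k v) ⊗ₜ
        PiTensorProduct.tprod k w)) : f = g := by
  apply TensorProduct.ext
  apply tmul_ext
  intro u v
  apply PiTensorProduct.ext
  ext w
  exact h u v w


/-- The action of a bijection on pure tensors. -/
def perm {m n : ℕ} (σ : Fin m ≃ Fin n) :
    (⨂[k] (_ : Fin m), W) →ₗ[k] ⨂[k] (_ : Fin n), W :=
  (PiTensorProduct.reindex k (fun _ => W) σ).toLinearMap

theorem perm_tprod {m n : ℕ} (σ : Fin m ≃ Fin n) (w : Fin m → W) :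
    perm (k := k) W σ (PiTensorProduct.tprod k w) =
      PiTensorProduct.tprod k (fun i => w (σ.symm i)) :=
  PiTensorProduct.reindex_tprod _ _

theorem perm_concat {a b a' b' : ℕ} (σ : Fin a ≃ Fin a') (τ : Fin b ≃ Fin b') :
    concat (k := k) W a' b' ∘ₗ TensorProduct.map (perm W σ) (perm W τ) =
      perm W (FinBij.sumHom σ τ) ∘ₗ concat W a b := by
  apply tmul_ext
  intro v w
  simp only [LinearMap.comp_apply, TensorProduct.map_tmul, perm_tprod, concat_tprod,
    append_sumHom]

theorem perm_refl (a : ℕ) : perm (k := k) W (Equiv.refl (Fin a)) = LinearMap.id := by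
  apply PiTensorProduct.ext
  ext w
  exact perm_tprod _ _ _

theorem concat_nil_left (a : ℕ) (r : k) (x : ⨂[k] (_ : Fin a), W) :
    perm W (FinBij.zeroBlock a) (concat W 0 a
      ((r • PiTensorProduct.tprod k (fun i : Fin 0 => i.elim0)) ⊗ₜ x)) = r • x := by
  have : perm W (FinBij.zeroBlock a) ∘ₗ concat W 0 a ∘ₗ
      TensorProduct.mk k _ _ (PiTensorProduct.tprod k (fun i : Fin 0 => i.elim0)) =
        LinearMap.id := by
    apply PiTensorProduct.ext
    ext w
    simp only [LinearMap.compMultilinearMap_apply, LinearMap.comp_apply, TensorProduct.mk_apply,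
      concat_tprod, perm_tprod, append_zeroBlock, LinearMap.id_apply]
  rw [← TensorProduct.smul_tmul', map_smul, map_smul]
  exact congrArg (r • ·) (LinearMap.congr_fun this x)

theorem concat_nil_right (a : ℕ) (r : k) (x : ⨂[k] (_ : Fin a), W) :
    perm W (FinBij.zeroBlockRight a) (concat W a 0
      (x ⊗ₜ (r • PiTensorProduct.tprod k (fun i : Fin 0 => i.elim0)))) = r • x := by
  have : perm W (FinBij.zeroBlockRight a) ∘ₗ concat W a 0 ∘ₗ
      (TensorProduct.mk k _ _).flip (PiTensorProduct.tprod k (fun i : Fin 0 => i.elim0)) =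
        LinearMap.id := by
    apply PiTensorProduct.ext
    ext w
    simp only [LinearMap.compMultilinearMap_apply, LinearMap.comp_apply, LinearMap.flip_apply,
      TensorProduct.mk_apply, concat_tprod, perm_tprod, append_zeroBlockRight, LinearMap.id_apply]
  rw [TensorProduct.tmul_smul, map_smul, map_smul]
  exact congrArg (r • ·) (LinearMap.congr_fun this x)

instance : (tensorFunctor (k := k) W).LaxBraided where
  ε := ModuleCat.ofHom (LinearMap.toSpanSingleton k _
    (PiTensorProduct.tprod k (fun i : Fin 0 => i.elim0)))
  μ m n := ModuleCat.ofHom (concat W m.card n.card)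
  μ_natural_left {m n} f l := by
    have := perm_concat (k := k) W (show Fin m.card ≃ Fin n.card from f) (Equiv.refl (Fin l.card))
    rw [perm_refl] at this
    exact ModuleCat.hom_ext this
  μ_natural_right {m n} l f := by
    have := perm_concat (k := k) W (Equiv.refl (Fin l.card)) (show Fin m.card ≃ Fin n.card from f)
    rw [perm_refl] at this
    exact ModuleCat.hom_ext this
  associativity l m n := by
    apply ModuleCat.hom_ext
    apply tmul_ext₃
    intro u v w
    have h : perm W (FinBij.assocBlocks l.card m.card n.card) (concat W _ _ (concat W _ _
        (PiTensorProduct.tprod k u ⊗ₜ PiTensorProduct.tprod k v) ⊗ₜ PiTensorProduct.tprod k w)) =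
      concat W _ _ (PiTensorProduct.tprod k u ⊗ₜ concat W _ _
        (PiTensorProduct.tprod k v ⊗ₜ PiTensorProduct.tprod k w)) := by
      simp only [concat_tprod, perm_tprod, append_assocBlocks]
    exact h
  left_unitality n := by
    apply ModuleCat.hom_ext
    apply TensorProduct.ext'
    intro r x
    exact (concat_nil_left W n.card r x).symm
  right_unitality n := by
    apply ModuleCat.hom_ext
    apply TensorProduct.ext'
    intro x r
    exact (concat_nil_right W n.card r x).symm
  braided m n := by
    apply ModuleCat.hom_ext
    apply tmul_ext
    intro v w
    have h : perm W (FinBij.swapBlocks m.card n.card) (concat W _ _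
        (PiTensorProduct.tprod k v ⊗ₜ PiTensorProduct.tprod k w)) =
      concat W _ _ (PiTensorProduct.tprod k w ⊗ₜ PiTensorProduct.tprod k v) := by
      simp only [concat_tprod, perm_tprod, append_swapBlocks]
    exact h

variable (k) in
/-- The tensor algebra `T(W)`, as a sequence of representations of the symmetric groups. Its
structure of commutative algebra object, i.e. of twisted commutative algebra, has the unit
`1 ∈ T(W)_0 = k` and the concatenation of tensors as multiplication. -/
abbrev tensorAlg : SymSeq k := DayFunctor.mk (tensorFunctor (k := k) W)

end SymSeq
end

/-! Part (1). The filtration of `A` generated by `W` is multiplicative, so `V ≤ genFiltration W m`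
forces `genFiltration V n ≤ genFiltration W (m * n)`: passing from `W` to `V` rescales `n` by a
constant, which does not change the exponents. Such an `m` exists because `V` is noetherian and
filtered colimits are exact: the kernels of the maps from `V` to the quotients of `A` by the
filtration increase to `V`, hence one of them is `V` (`exists_le_of_exhaustive`). This gives
`growthExponents_eq`.

Part (2). By (1) it suffices to use the degree one component `degOne`, whose filtration is the
filtration by degree. A subobject of a sequence of representations is a family of
subrepresentations, so the growth is the sum over `m ≤ n` of the lengths of the representations
`W^{⊗m}`.

Let `d = dim W`. In a basis, the endomorphisms of `W^{⊗m}` are the matrices indexed by words of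
length `m` that are invariant under permutations of the positions. The orbits of pairs of words
correspond to the `d × d` matrices over `ℕ` of total sum `m`, and transposition transposes these.
The claim is that the length is the number of symmetric ones (`WordMatrix.height_top_eq_card`). It
follows by computing the trace of `a ↦ aᵀ` on the rational algebra of invariant matrices in two
ways. The orbit basis gives the number of symmetric matrices. A decomposition of `1` into orthogonal
primitive symmetric idempotents gives their number, provided that `e a e` is always a multiple of
`e`; they then cut the semisimple representation into as many simple pieces, over every field of
characteristic zero.

That proviso (`IsPrimSymIdem.mul_mul_mem_span`) is a highest weight argument. An orbit matrix
joining two different words of the same weight is, up to orbit matrices with lexicographically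
larger diagonal, a product through a larger weight (`mid_dichotomy`); at a maximal weight seen by
`e` such products vanish and only scalars survive. Positivity of `cᵀ c` over `ℚ` replaces the
general structure theory of semisimple algebras.

Finally a symmetric matrix has `(d + 1).choose 2` free entries, so the number of those with total
sum at most `n` lies between two constant multiples of `n ^ (d + 1).choose 2`. -/

/-! ### Products of tensor powers in a monoidal category -/

section Monoidal

variable {C : Type u₁} [Category.{v₁} C] [MonoidalCategory C]

/-- This is the associativity of the multiplication. Only the factorization matters later, to show
that the filtration is multiplicative, so the comparison map is left unspecified. -/
theorem exists_comp_powToAlg_add {V A : C} [MonObj A] (v : V ⟶ A) (i j : ℕ) :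
    ∃ c : tensorPow V i ⊗ tensorPow V j ⟶ tensorPow V (i + j),
      c ≫ powToAlg v (i + j) = (powToAlg v i ⊗ₘ powToAlg v j) ≫ MonObj.mul := by
  induction j with
  | zero =>
    refine ⟨(ρ_ _).hom, ?_⟩
    change _ = (powToAlg v i ⊗ₘ MonObj.one) ≫ MonObj.mul
    rw [MonoidalCategory.tensorHom_def, Category.assoc, MonObj.mul_one]
    exact (rightUnitor_naturality _).symm
  | succ j ih =>
    obtain ⟨c, hc⟩ := ih
    refine ⟨(α_ _ _ _).inv ≫ c ▷ V, ?_⟩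
    change (_ ≫ _) ≫ (powToAlg v (i + j) ⊗ₘ v) ≫ MonObj.mul =
      (powToAlg v i ⊗ₘ ((powToAlg v j ⊗ₘ v) ≫ MonObj.mul)) ≫ MonObj.mul
    rw [Category.assoc, ← tensorHom_id, tensorHom_comp_tensorHom_assoc, Category.id_comp, hc]
    have h₁ : ((powToAlg v i ⊗ₘ powToAlg v j) ≫ MonObj.mul) ⊗ₘ v =
        ((powToAlg v i ⊗ₘ powToAlg v j) ⊗ₘ v) ≫ MonObj.mul ▷ A := by
      rw [← tensorHom_id, tensorHom_comp_tensorHom, Category.comp_id]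
    have h₂ : powToAlg v i ⊗ₘ ((powToAlg v j ⊗ₘ v) ≫ MonObj.mul) =
        (powToAlg v i ⊗ₘ (powToAlg v j ⊗ₘ v)) ≫ A ◁ MonObj.mul := by
      rw [← id_tensorHom, tensorHom_comp_tensorHom, Category.comp_id]
    rw [h₁, h₂, Category.assoc, MonObj.mul_assoc, associator_naturality_assoc,
      Iso.inv_hom_id_assoc, Category.assoc]

theorem tensorHom_mul_comm [BraidedCategory C] {A : C} [MonObj A] [IsCommMonObj A]
    {X Y : C} (f : X ⟶ A) (g : Y ⟶ A) :
    (f ⊗ₘ g) ≫ MonObj.mul = (β_ X Y).hom ≫ (g ⊗ₘ f) ≫ MonObj.mul := by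
  rw [← BraidedCategory.braiding_naturality_assoc, IsCommMonObj.mul_comm]

theorem epi_whiskerRight [BraidedCategory C] [∀ X : C, (tensorLeft X).PreservesEpimorphisms]
    {X Y : C} (e : X ⟶ Y) [Epi e] (Z : C) : Epi (e ▷ Z) := by
  have : Epi (Z ◁ e) := inferInstanceAs (Epi ((tensorLeft Z).map e))
  have h : e ▷ Z = (β_ X Z).hom ≫ Z ◁ e ≫ (β_ Y Z).inv := by
    rw [← BraidedCategory.braiding_naturality_left_assoc, Iso.hom_inv_id, Category.comp_id]
  rw [h]
  infer_instance

end Monoidal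

/-! ### The filtration generated by a subobject, and independence of the generators -/

section GeneralFiltration

variable {C : Type u₁} [Category.{v₁} C]

/-- The length of a subobject is its height in the lattice of subobjects. -/
theorem objLength_eq_height {A : C} (U : Subobject A) :
    objLength (U : C) = Order.height U := by
  unfold objLength
  rw [← Order.height_orderIso (Subobject.subobjectOrderIso U), map_top]
  have h := Order.height_eq_krullDim_Iic U
  rw [← Order.height_top_eq_krullDim] at h
  exact_mod_cast h.symm

variable [Abelian C]

theorem subobject_factors_iff {A X : C} (S : Subobject A) (f : X ⟶ A) :
    S.Factors f ↔ f ≫ cokernel.π S.arrow = 0 := by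
  constructor
  · intro h
    rw [← S.factorThru_arrow f h, Category.assoc, cokernel.condition, comp_zero]
  · intro h
    rw [← Abelian.monoLift_comp S.arrow f h]
    exact Subobject.factors_comp_arrow _

theorem imageSubobject_le_iff {A X : C} (S : Subobject A) (f : X ⟶ A) :
    imageSubobject f ≤ S ↔ S.Factors f := by
  constructor
  · intro h
    refine Subobject.factors_of_le f h ?_
    simpa using imageSubobject_factors_comp_self f (𝟙 X)
  · intro h
    exact imageSubobject_le f (S.factorThru f h) (S.factorThru_arrow f h)

theorem sigma_hom_eq_zero {ι : Type} [Finite ι] {X : ι → C} {Z : C} {h : ∐ X ⟶ Z}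
    (hh : ∀ i, Sigma.ι X i ≫ h = 0) : h = 0 :=
  Sigma.hom_ext _ _ fun i => by rw [hh, comp_zero]

open IsGrothendieckAbelian.IsPresentable.injectivity₀ in
/-- A morphism from an object of finite length that vanishes in a filtered colimit vanishes at a
finite stage. -/
theorem exists_comp_map_eq_zero [IsGrothendieckAbelian.{w} C] {J : Type w} [SmallCategory J]
    [IsFiltered J] {Y : J ⥤ C} {c : Cocone Y} (hc : IsColimit c) {X : C}
    [WellFoundedGT (Subobject X)] {j₀ : J} (y : X ⟶ Y.obj j₀) (hy : y ≫ c.ι.app j₀ = 0) :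
    ∃ (j : J) (φ : j₀ ⟶ j), y ≫ Y.map φ = 0 := by
  have hf' : ∀ j : Under j₀, (colimit.cocone (kernel (g y))).ι.app j ≫ f y =
      ((F y).obj j).obj.hom := fun j => by simpa using! hf y j
  have hm := IsGrothendieckAbelian.mono_of_isColimit_monoOver (F y)
    (colimit.isColimit (kernel (g y))) (f y) hf'
  have hs := IsGrothendieckAbelian.subobjectMk_of_isColimit_eq_iSup (F y)
    (colimit.isColimit (kernel (g y))) (f y) hf'
  -- Exactness of filtered colimits: the kernels of the maps from `X` to the later stages have
  -- colimit `X`, because `y` dies in the colimit.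
  have he : Epi (f y) := epi_f hc hy
  rw [(Subobject.epi_iff_mk_eq_top (f y)).mp he] at hs
  let s : Under j₀ → Subobject X := fun j => Subobject.mk ((F y).obj j).obj.hom
  -- The ascending chain condition gives a maximal kernel; as the family is directed, it equals the
  -- supremum `⊤`.
  obtain ⟨_, ⟨j, rfl⟩, hj⟩ := WellFounded.has_min (wellFounded_gt (α := Subobject X))
    (Set.range s) ⟨_, Under.mk (𝟙 j₀), rfl⟩
  have htop : s j = ⊤ := by
    rw [← top_le_iff, hs, iSup_le_iff]
    intro i
    have h₁ : s j ≤ s (IsFiltered.max i j) :=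
      MonoOver.subobjectMk_le_mk_of_hom ((F y).map (IsFiltered.rightToMax i j))
    have h₂ : s i ≤ s (IsFiltered.max i j) :=
      MonoOver.subobjectMk_le_mk_of_hom ((F y).map (IsFiltered.leftToMax i j))
    have h₃ : ¬ s j < s (IsFiltered.max i j) := fun h => hj _ ⟨_, rfl⟩ h
    rw [eq_of_le_of_not_lt h₁ h₃]
    exact h₂
  have : IsIso ((F y).obj j).obj.hom := (Subobject.isIso_iff_mk_eq_top _).mpr htop
  have : IsIso ((kernel.ι (g y)).app j) := this
  refine ⟨j.right, j.hom, ?_⟩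
  simpa only [← cancel_epi ((kernel.ι (g y)).app j), comp_zero]
    using! NatTrans.congr_app (kernel.condition (g y)) j

/-- A subobject of finite length is contained in some member of an exhaustive increasing
sequence of subobjects. -/
theorem exists_le_of_exhaustive [IsGrothendieckAbelian.{w} C] {A : C} (U : ℕ → Subobject A)
    (hU : Monotone U) (hex : ∀ ⦃Z : C⦄ (f : A ⟶ Z), (∀ n, (U n).arrow ≫ f = 0) → f = 0)
    (V : Subobject A) (hV : objLength (V : C) ≠ ⊤) : ∃ n, V ≤ U n := by
  -- The quotients of `A` by the `U n`. Exhaustiveness says that `A` maps to zero in their colimit.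
  -- The lift puts the index category in the universe for which filtered colimits are known to be
  -- exact.
  let Y : ULift.{w} ℕ ⥤ C :=
    { obj := fun j => cokernel (U j.down).arrow
      map := fun {i j} f => cokernel.desc _ (cokernel.π (U j.down).arrow) (by
        rw [← Subobject.ofLE_arrow (hU (show i.down ≤ j.down from f.down.down)), Category.assoc,
          cokernel.condition, comp_zero])
      map_id := fun j => by
        rw [← cancel_epi (cokernel.π _)]
        simp
      map_comp := fun f g => by
        rw [← cancel_epi (cokernel.π _)]
        simp }
  have : FiniteDimensionalOrder (Subobject (V : C)) := by
    rw [Order.finiteDimensionalOrder_iff_krullDim_ne_bot_and_top]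
    rw [← Order.height_top_eq_krullDim]
    refine ⟨WithBot.coe_ne_bot, fun h => hV ?_⟩
    exact WithBot.coe_injective h
  let R : SetRel (Subobject (V : C)) (Subobject (V : C)) := {p | p.1 < p.2}
  have : WellFoundedGT (Subobject (V : C)) := ⟨by
    have : R.FiniteDimensional := this
    change R.inv.IsWellFounded
    exact .of_finiteDimensional R.inv⟩
  have hmap : ∀ {i j : ULift.{w} ℕ} (f : i ⟶ j), cokernel.π (U i.down).arrow ≫ Y.map f =
      cokernel.π (U j.down).arrow := fun f => cokernel.π_desc _ _ _
  obtain ⟨j, φ, h⟩ := exists_comp_map_eq_zero (colimit.isColimit Y) (j₀ := ⟨0⟩)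
    (V.arrow ≫ cokernel.π (U 0).arrow) (by
      have : cokernel.π (U 0).arrow ≫ (colimit.cocone Y).ι.app ⟨0⟩ = 0 := by
        apply hex
        intro n
        have hw := (colimit.cocone Y).w (homOfLE (Nat.zero_le n) :
          (⟨0⟩ : ULift.{w} ℕ) ⟶ ⟨n⟩)
        rw [← hw]
        have := hmap (homOfLE (Nat.zero_le n) : (⟨0⟩ : ULift.{w} ℕ) ⟶ ⟨n⟩)
        dsimp only at this
        rw [← Category.assoc (cokernel.π _), this, cokernel.condition_assoc, zero_comp]
      rw [Category.assoc, this, comp_zero])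
  refine ⟨j.down, Subobject.le_of_factors ?_⟩
  rw [subobject_factors_iff, ← hmap φ, ← Category.assoc]
  exact h

variable [MonoidalCategory C]

/-- The tensor product is only assumed additive, but this suffices for finite coproducts: the
identity of `∐ X` is the sum of the composites `p i ≫ Sigma.ι X i`, and the sum can be pulled out of
the tensor product. Here `q` is meant to be the cokernel of a subobject, so that vanishing tests
factorization. -/
theorem tensorHom_mul_eq_zero_of_sigma [MonoidalPreadditive C] {A Q : C} [MonObj A] (q : A ⟶ Q)
    {ι : Type} [Fintype ι] {X : ι → C} {Y : C}
    {f : ∐ X ⟶ A} {g : Y ⟶ A}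
    (h : ∀ i, ((Sigma.ι X i ≫ f) ⊗ₘ g) ≫ MonObj.mul ≫ q = 0) :
    (f ⊗ₘ g) ≫ MonObj.mul ≫ q = 0 := by
  classical
  let p : ∀ i, ∐ X ⟶ X i := fun i =>
    Sigma.desc fun j => if h : j = i then eqToHom (by rw [h]) else 0
  have hp : ∑ i, p i ≫ Sigma.ι X i = 𝟙 (∐ X) := by
    apply Sigma.hom_ext
    intro j
    rw [Preadditive.comp_sum, Finset.sum_eq_single j]
    · simp [p]
    · intro i _ hij
      simp [p, hij.symm]
    · simp
  have h₁ : (f ⊗ₘ g) = ∑ i, (p i ▷ Y) ≫ ((Sigma.ι X i ≫ f) ⊗ₘ g) := by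
    have hf : f = ∑ i, (p i ≫ Sigma.ι X i) ≫ f := by
      rw [← Preadditive.sum_comp, hp, Category.id_comp]
    conv_lhs => rw [hf, sum_tensor]
    refine Finset.sum_congr rfl fun i _ => ?_
    rw [← tensorHom_id, tensorHom_comp_tensorHom, Category.id_comp, Category.assoc]
  rw [h₁, Preadditive.sum_comp]
  exact Finset.sum_eq_zero fun i _ => by rw [Category.assoc, h, comp_zero]

theorem tensorHom_mul_eq_zero_of_epi [BraidedCategory C]
    [∀ X : C, (tensorLeft X).PreservesEpimorphisms] {A Q : C} [MonObj A] (q : A ⟶ Q)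
    {X X' Y : C} (e : X' ⟶ X) [Epi e] {f : X ⟶ A} {g : Y ⟶ A}
    (h : ((e ≫ f) ⊗ₘ g) ≫ MonObj.mul ≫ q = 0) : (f ⊗ₘ g) ≫ MonObj.mul ≫ q = 0 := by
  have := epi_whiskerRight e Y
  rw [← cancel_epi (e ▷ Y), comp_zero, ← h, ← tensorHom_id, tensorHom_comp_tensorHom_assoc,
    Category.id_comp]

variable [BraidedCategory C] {A : C} [MonObj A] [IsCommMonObj A]

/-- The projection from a tensor power to the symmetric power. -/
noncomputable def tensorPowToSymPow (V : C) (n : ℕ) : tensorPow V n ⟶ symPow V n := cokernel.π _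

instance (V : C) (n : ℕ) : Epi (tensorPowToSymPow V n) :=
  inferInstanceAs (Epi (cokernel.π _))

theorem tensorPowToSymPow_symToAlg {V : C} (v : V ⟶ A) (n : ℕ) :
    tensorPowToSymPow V n ≫ symToAlg v n = powToAlg v n :=
  cokernel.π_desc _ _ _

theorem factors_symToAlg_iff {V : C} (v : V ⟶ A) (n : ℕ) (S : Subobject A) :
    S.Factors (symToAlg v n) ↔ S.Factors (powToAlg v n) := by
  rw [subobject_factors_iff, subobject_factors_iff, ← tensorPowToSymPow_symToAlg v n, Category.assoc]
  constructor
  · intro h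
    rw [h, comp_zero]
  · intro h
    exact zero_of_epi_comp _ h

/-- Tensor powers map epimorphically onto symmetric powers, so they have the same image in `A`. From
here on the coinvariants play no role. -/
theorem genFiltration_le_iff (V : Subobject A) (n : ℕ) (S : Subobject A) :
    genFiltration V n ≤ S ↔ ∀ i ≤ n, S.Factors (powToAlg V.arrow i) := by
  unfold genFiltration
  rw [imageSubobject_le_iff]
  constructor
  · intro h i hi
    rw [← factors_symToAlg_iff]
    have := Subobject.factors_of_factors_right (P := S)
      (Sigma.ι (fun i : Fin (n + 1) => symPow (V : C) i) ⟨i, Nat.lt_succ_of_le hi⟩) h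
    rwa [Sigma.ι_desc] at this
  · intro h
    rw [subobject_factors_iff]
    apply sigma_hom_eq_zero
    intro i
    rw [Sigma.ι_desc_assoc, ← subobject_factors_iff, factors_symToAlg_iff]
    exact h i (Nat.le_of_lt_succ i.2)

theorem genFiltration_factors (V : Subobject A) {i n : ℕ} (h : i ≤ n) :
    (genFiltration V n).Factors (powToAlg V.arrow i) :=
  (genFiltration_le_iff V n _).mp le_rfl i h

theorem genFiltration_mono (V : Subobject A) : Monotone (genFiltration V) := fun _ _ hab =>
  (genFiltration_le_iff V _ _).mpr fun _ hi => genFiltration_factors V (hi.trans hab)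

theorem Generates.eq_zero {V : Subobject A} (hV : Generates V) {Z : C} (f : A ⟶ Z)
    (h : ∀ n, (genFiltration V n).arrow ≫ f = 0) : f = 0 := by
  apply hV
  intro i
  rw [comp_zero, ← cancel_epi (tensorPowToSymPow _ i), ← Category.assoc,
    tensorPowToSymPow_symToAlg, comp_zero,
    ← Subobject.factorThru_arrow _ _ (genFiltration_factors V (le_refl i)), Category.assoc, h,
    comp_zero]

theorem generates_of_forall_eq_zero {V : Subobject A}
    (h : ∀ ⦃Z : C⦄ (f : A ⟶ Z), (∀ n, powToAlg V.arrow n ≫ f = 0) → f = 0) : Generates V := by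
  intro Z f g hfg
  rw [← sub_eq_zero]
  apply h
  intro n
  rw [← tensorPowToSymPow_symToAlg, Category.assoc, Preadditive.comp_sub, hfg, sub_self, comp_zero]

section Product

variable {Q : C} (q : A ⟶ Q)

theorem tensorHom_mul_eq_zero_comm {X Y : C} {f : X ⟶ A} {g : Y ⟶ A}
    (h : (f ⊗ₘ g) ≫ MonObj.mul ≫ q = 0) : (g ⊗ₘ f) ≫ MonObj.mul ≫ q = 0 := by
  rw [← Category.assoc, tensorHom_mul_comm, Category.assoc, Category.assoc, h, comp_zero]

variable [MonoidalPreadditive C] [∀ X : C, (tensorLeft X).PreservesEpimorphisms]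

/-- The tensor product need not preserve monomorphisms, so a product with a member of the filtration
is tested on its epimorphic cover by tensor powers. -/
theorem genFiltration_arrow_tensorHom_mul_eq_zero (V : Subobject A) (n : ℕ) {Y : C} {g : Y ⟶ A}
    (h : ∀ i ≤ n, (powToAlg V.arrow i ⊗ₘ g) ≫ MonObj.mul ≫ q = 0) :
    ((genFiltration V n).arrow ⊗ₘ g) ≫ MonObj.mul ≫ q = 0 := by
  apply tensorHom_mul_eq_zero_of_epi q
    (factorThruImageSubobject (Sigma.desc fun i : Fin (n + 1) => symToAlg V.arrow i))
  have : factorThruImageSubobject (Sigma.desc fun i : Fin (n + 1) => symToAlg V.arrow i) ≫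
      (genFiltration V n).arrow = Sigma.desc fun i : Fin (n + 1) => symToAlg V.arrow i :=
    imageSubobject_arrow_comp _
  rw [this]
  apply tensorHom_mul_eq_zero_of_sigma
  intro i
  rw [Sigma.ι_desc]
  apply tensorHom_mul_eq_zero_of_epi q (tensorPowToSymPow _ _)
  rw [tensorPowToSymPow_symToAlg]
  exact h i (Nat.le_of_lt_succ i.2)

/-- The filtration is multiplicative. -/
theorem genFiltration_mul_factors (V : Subobject A) (a b : ℕ) :
    (genFiltration V (a + b)).Factors
      (((genFiltration V a).arrow ⊗ₘ (genFiltration V b).arrow) ≫ MonObj.mul) := by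
  rw [subobject_factors_iff, Category.assoc]
  apply genFiltration_arrow_tensorHom_mul_eq_zero
  intro i hi
  -- Commutativity exchanges the two factors, so that the same one-sided reduction applies to the
  -- second one.
  apply tensorHom_mul_eq_zero_comm
  apply genFiltration_arrow_tensorHom_mul_eq_zero
  intro j hj
  apply tensorHom_mul_eq_zero_comm
  obtain ⟨c, hc⟩ := exists_comp_powToAlg_add V.arrow i j
  rw [← Category.assoc, ← hc, Category.assoc,
    (subobject_factors_iff _ _).mp (genFiltration_factors V (Nat.add_le_add hi hj)), comp_zero]

/-- By induction on `i`, multiplicativity sends a product of `i` elements of level `m` to level `m *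
i`. -/
theorem genFiltration_le_of_le (V W : Subobject A) (m n : ℕ) (h : V ≤ genFiltration W m) :
    genFiltration V n ≤ genFiltration W (m * n) := by
  rw [genFiltration_le_iff]
  intro i hi
  refine Subobject.factors_of_le _ (genFiltration_mono W (Nat.mul_le_mul_left m hi)) ?_
  clear hi
  induction i with
  | zero => exact genFiltration_factors W (i := 0) (Nat.zero_le _)
  | succ i ih =>
    change Subobject.Factors _ ((powToAlg V.arrow i ⊗ₘ V.arrow) ≫ MonObj.mul)
    have h₁ := Subobject.factorThru_arrow _ _ ih
    have h₂ : powToAlg V.arrow i ⊗ₘ V.arrow = (Subobject.factorThru _ _ ih ⊗ₘ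
        Subobject.ofLE _ _ h) ≫
          ((genFiltration W (m * i)).arrow ⊗ₘ (genFiltration W m).arrow) := by
      rw [tensorHom_comp_tensorHom, h₁, Subobject.ofLE_arrow]
    rw [h₂, Category.assoc]
    exact Subobject.factors_of_factors_right _ (genFiltration_mul_factors W (m * i) m)

/-- If `V` lies in a member of the filtration defined by `W`, then `W`-growth bounds `V`-growth. -/
theorem growthExponents_subset (V W : Subobject A) (m : ℕ) (h : V ≤ genFiltration W m) :
    growthExponents W ⊆ growthExponents V := by
  rintro r ⟨c, hc⟩
  -- The factor is `m + 1` and not `m`, because the bound for `W` is only available at positive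
  -- arguments and `m` may be `0`.
  refine ⟨c * ((m + 1 : ℕ) : ℝ) ^ r, fun n hn => ?_⟩
  have h' : V ≤ genFiltration W (m + 1) := h.trans (genFiltration_mono W (Nat.le_succ m))
  have h₁ : growth V n ≤ growth W ((m + 1) * n) := by
    unfold growth
    rw [objLength_eq_height, objLength_eq_height]
    exact Order.height_mono (genFiltration_le_of_le V W _ _ h')
  have h₂ := hc ((m + 1) * n) (Nat.mul_pos (Nat.succ_pos m) hn)
  rw [Nat.cast_mul, Real.mul_rpow (Nat.cast_nonneg _) (Nat.cast_nonneg _), ← mul_assoc] at h₂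
  exact le_trans (by exact_mod_cast h₁) h₂

/-- The set of growth exponents does not depend on the generating subobject. -/
theorem growthExponents_eq [IsGrothendieckAbelian.{w} C] (V W : Subobject A)
    (hV : IsFiniteLengthGenerating V) (hW : IsFiniteLengthGenerating W) :
    growthExponents V = growthExponents W := by
  obtain ⟨a, ha⟩ := exists_le_of_exhaustive.{w} (genFiltration W) (genFiltration_mono W)
    (fun _ f => hW.2.eq_zero f) V hV.1
  obtain ⟨b, hb⟩ := exists_le_of_exhaustive.{w} (genFiltration V) (genFiltration_mono V)
    (fun _ f => hV.2.eq_zero f) W hW.1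
  exact Set.Subset.antisymm (growthExponents_subset W V b hb) (growthExponents_subset V W a ha)

theorem gkDimWrt_eq [IsGrothendieckAbelian.{w} C] (V W : Subobject A)
    (hV : IsFiniteLengthGenerating V) (hW : IsFiniteLengthGenerating W) :
    gkDimWrt V = gkDimWrt W := by
  unfold gkDimWrt
  rw [growthExponents_eq.{w} V W hV hW]

theorem gkDim_eq_gkDimWrt [IsGrothendieckAbelian.{w} C] (V : Subobject A)
    (hV : IsFiniteLengthGenerating V) : gkDim A = gkDimWrt V := by
  unfold gkDim
  exact le_antisymm (iInf₂_le V hV)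
    (le_iInf₂ fun W hW => (gkDimWrt_eq.{w} V W hV hW).le)

end Product

end GeneralFiltration

/-- Functors on `J` are the sheaves on `Jᵒᵖ` for the trivial topology, and sheaf categories are
Grothendieck abelian. -/
theorem isGrothendieckAbelian_functor (J : Type) [SmallCategory J] (k : Type u₁) [Field k] :
    IsGrothendieckAbelian.{u₁} (J ⥤ ModuleCat.{u₁} k) := by
  have : IsGrothendieckAbelian.{u₁} (Sheaf (⊥ : GrothendieckTopology Jᵒᵖ) (ModuleCat.{u₁} k)) :=
    Sheaf.isGrothendieckAbelian_of_essentiallySmall _ _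
  have := IsGrothendieckAbelian.of_equivalence (sheafBotEquivalence (C := Jᵒᵖ) (ModuleCat.{u₁} k))
  exact IsGrothendieckAbelian.of_equivalence ((opOpEquivalence J).congrLeft (E := ModuleCat.{u₁} k))

/-! ### Sequences of representations satisfy the general hypotheses -/

namespace SymSeq

variable (k : Type u₁) [Field k]

instance : IsGrothendieckAbelian.{u₁} (SymSeq k) :=
  have := isGrothendieckAbelian_functor FinBij k
  IsGrothendieckAbelian.of_equivalence (DayFunctor.equiv FinBij (ModuleCat.{u₁} k)).symm

open DaySymm
variable {k}

theorem epi_app {F G : SymSeq k} (f : F ⟶ G) [Epi f] (x : FinBij) : Epi (f.natTrans.app x) := by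
  have : Epi f.natTrans :=
    inferInstanceAs (Epi ((DayFunctor.equiv FinBij (ModuleCat.{u₁} k)).functor.map f))
  infer_instance

theorem mono_app {F G : SymSeq k} (f : F ⟶ G) [Mono f] (x : FinBij) : Mono (f.natTrans.app x) := by
  have : Mono f.natTrans :=
    inferInstanceAs (Mono ((DayFunctor.equiv FinBij (ModuleCat.{u₁} k)).functor.map f))
  infer_instance

theorem add_app {F G : SymSeq k} (f g : F ⟶ G) (x : FinBij) :
    (f + g).natTrans.app x = f.natTrans.app x + g.natTrans.app x := rfl

theorem zero_app {F G : SymSeq k} (x : FinBij) :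
    (0 : F ⟶ G).natTrans.app x = 0 := rfl

/-- A map out of a Day convolution is determined by its components on the tensor products of values.
This reduces the claim, and likewise additivity below, to vector spaces. -/
instance (F : SymSeq k) : (tensorLeft F).PreservesEpimorphisms where
  preserves {G H} f _ := ⟨fun {K} g h hgh => by
    apply DayFunctor.tensor_hom_ext
    intro x y
    have := epi_app f y
    have e : Epi (F.functor.obj x ◁ f.natTrans.app y) :=
      inferInstanceAs (Epi ((tensorLeft (F.functor.obj x)).map (f.natTrans.app y)))
    rw [← cancel_epi (F.functor.obj x ◁ f.natTrans.app y)]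
    have hc := congrArg (fun t => t.natTrans.app (x ⊗ y)) hgh
    simp only [DayFunctor.comp_natTrans, NatTrans.comp_app] at hc
    change (F ◁ f).natTrans.app _ ≫ _ = (F ◁ f).natTrans.app _ ≫ _ at hc
    rw [← reassoc_of% η_whiskerLeft, ← reassoc_of% η_whiskerLeft, hc]⟩

instance : MonoidalPreadditive (SymSeq k) where
  whiskerLeft_zero {F G H} := by
    apply DayFunctor.tensor_hom_ext
    intro x y
    rw [η_whiskerLeft, zero_app, zero_app]
    simp
  zero_whiskerRight {F G H} := by
    apply DayFunctor.tensor_hom_ext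
    intro x y
    rw [η_whiskerRight, zero_app, zero_app]
    simp
  whiskerLeft_add {F G H} f g := by
    apply DayFunctor.tensor_hom_ext
    intro x y
    rw [η_whiskerLeft, add_app, add_app, Preadditive.comp_add, η_whiskerLeft, η_whiskerLeft,
      MonoidalPreadditive.whiskerLeft_add, Preadditive.add_comp]
  add_whiskerRight {F G H} f g := by
    apply DayFunctor.tensor_hom_ext
    intro x y
    rw [η_whiskerRight, add_app, add_app, Preadditive.comp_add, η_whiskerRight, η_whiskerRight,
      MonoidalPreadditive.add_whiskerRight, Preadditive.add_comp]

end SymSeq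

/-! ### Heights in products of bounded orders -/

section Height

/-- A chain ending at `a` is continued by the image under `g` of a chain ending at `l`. -/
theorem height_add_height_le {P L : Type*} [PartialOrder P] [PartialOrder L] [OrderBot L] {a : P}
    {g : L → P} (hg : StrictMono g) (ha : a ≤ g ⊥) (l : L) :
    Order.height a + Order.height l ≤ Order.height (g l) := by
  have key : ∀ (N : ℕ) (l : L), (N : ℕ∞) ≤ Order.height l →
      Order.height a + N ≤ Order.height (g l) := by
    intro N
    induction N with
    | zero =>
      intro l _
      simpa using Order.height_mono (ha.trans (hg.monotone bot_le))
    | succ N ih =>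
      intro l hl
      obtain ⟨p, rfl, hp⟩ := Order.exists_series_of_le_height l hl
      have h₁ := Order.index_le_height p ⟨N, by omega⟩
      have h₂ := ih _ h₁
      have h₃ : p ⟨N, by omega⟩ < p.last := p.strictMono (by
        simp [Fin.lt_def, hp])
      calc Order.height a + ((N + 1 : ℕ) : ℕ∞) = (Order.height a + N) + 1 := by
            push_cast; rw [add_assoc]
        _ ≤ Order.height (g (p ⟨N, by omega⟩)) + 1 := by gcongr
        _ ≤ _ := Order.height_add_one_le (hg h₃)
  -- Arbitrarily long chains below `l` settle the infinite case; otherwise `key` is applied to the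
  -- height itself.
  rcases eq_or_ne (Order.height l) ⊤ with h | h
  · rw [h, add_top, top_le_iff, ENat.eq_top_iff_forall_ge]
    intro N
    exact (le_add_left le_rfl).trans (key N l (h ▸ le_top))
  · obtain ⟨N, hN⟩ := ENat.ne_top_iff_exists.mp h
    rw [← hN]
    exact key N l hN.le

variable {L : ℕ → Type*} [∀ m, PartialOrder (L m)] [∀ m, BoundedOrder (L m)]

/-- The element of a product of bounded orders that is `⊤` in the degrees at most `n` and `⊥` in the
other degrees. -/
def truncTop (L : ℕ → Type*) [∀ m, PartialOrder (L m)] [∀ m, BoundedOrder (L m)] (n : ℕ) (m : ℕ) :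
    L m := if m ≤ n then ⊤ else ⊥

/-- Below `truncTop L n` the sum of the heights of the components is a strictly increasing function
with values in `ℕ`. Finiteness of the heights is what makes it strict. -/
theorem height_truncTop_le (h : ∀ m, Order.height (⊤ : L m) ≠ ⊤) (n : ℕ) :
    Order.height (truncTop L n) ≤ ∑ m ∈ Finset.range (n + 1), Order.height (⊤ : L m) := by
  have hfin : ∀ m (x : L m), Order.height x < ⊤ := fun m x =>
    (Order.height_mono le_top).trans_lt (lt_top_iff_ne_top.mpr (h m))
  let f : Set.Iic (truncTop L n) → ℕ := fun y =>
    ∑ m ∈ Finset.range (n + 1), (Order.height (y.1 m)).toNat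
  have hf : StrictMono f := by
    intro x y hxy
    have hmono : ∀ m, (Order.height (x.1 m)).toNat ≤ (Order.height (y.1 m)).toNat := fun m =>
      ENat.toNat_le_toNat (Order.height_mono (hxy.le m)) (hfin m _).ne
    obtain ⟨hle, m, hm⟩ := Pi.lt_def.mp (show x.1 < y.1 from hxy)
    have hmn : m ∈ Finset.range (n + 1) := by
      rw [Finset.mem_range, Nat.lt_succ_iff]
      by_contra hmn
      have := y.2 m
      simp only [truncTop, if_neg hmn, le_bot_iff] at this
      rw [this] at hm
      exact not_lt_bot hm
    refine Finset.sum_lt_sum (fun m _ => hmono m) ⟨m, hmn, ?_⟩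
    have := Order.height_strictMono hm (hfin m _)
    rw [← ENat.natCast_toNat (hfin m (x.1 m)).ne, ← ENat.natCast_toNat (hfin m (y.1 m)).ne] at this
    exact_mod_cast this
  have h₁ := Order.height_le_height_apply_of_strictMono f hf ⟨truncTop L n, Set.mem_Iic.mpr le_rfl⟩
  have h₂ : Order.height (⟨truncTop L n, Set.mem_Iic.mpr le_rfl⟩ : Set.Iic (truncTop L n)) =
      Order.height (truncTop L n) := by
    have h := Order.height_eq_krullDim_Iic (truncTop L n)
    rw [← Order.height_top_eq_krullDim] at h
    exact_mod_cast h.symm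
  rw [h₂, Order.height_nat] at h₁
  refine h₁.trans ?_
  simp only [f]
  rw [Nat.cast_sum]
  refine Finset.sum_le_sum fun m hm => ?_
  rw [ENat.natCast_toNat (hfin m _).ne]
  exact Order.height_mono le_top

/-- Chains are concatenated degree by degree: once the degrees up to `n` are full, a chain in degree
`n + 1` is appended. -/
theorem le_height_truncTop (n : ℕ) :
    ∑ m ∈ Finset.range (n + 1), Order.height (⊤ : L m) ≤ Order.height (truncTop L n) := by
  classical
  have hg : ∀ (n : ℕ) (x : ∀ m, L m), StrictMono fun l : L n => Function.update x n l :=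
    fun n x a b hab => update_lt_update_iff.mpr hab
  induction n with
  | zero =>
    have := height_add_height_le (hg 0 (⊥ : ∀ m, L m)) (a := (⊥ : ∀ m, L m)) bot_le (⊤ : L 0)
    have e : Function.update (⊥ : ∀ m, L m) 0 ⊤ = truncTop L 0 := by
      funext m
      rcases m with _ | m <;> simp [truncTop]
    rw [e] at this
    simpa using this
  | succ n ih =>
    rw [Finset.sum_range_succ]
    have := height_add_height_le (hg (n + 1) (truncTop L n)) (a := truncTop L n)
      (by
        rw [le_update_iff]
        exact ⟨by simp [truncTop], fun _ _ => le_rfl⟩) (⊤ : L (n + 1))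
    have e : Function.update (truncTop L n) (n + 1) ⊤ = truncTop L (n + 1) := by
      funext m
      rcases eq_or_ne m (n + 1) with rfl | hm
      · simp [truncTop]
      · have : m ≤ n ↔ m ≤ n + 1 := by omega
        simp [truncTop, Function.update_of_ne hm, this]
    rw [e] at this
    exact (add_le_add_left ih _).trans this

end Height

/-! ### Subobjects of a sequence of representations as families of subrepresentations -/

namespace SymSeq

variable {k : Type u₁} [Field k]

/-- The representation of the symmetric group in degree `m`. -/
def rep (F : SymSeq k) (m : ℕ) :
    Representation k (Equiv.Perm (Fin m)) (F.functor.obj ⟨m⟩) where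
  toFun σ := (F.functor.map (show (⟨m⟩ : FinBij) ⟶ ⟨m⟩ from σ)).hom
  map_one' := by
    change (F.functor.map (𝟙 (⟨m⟩ : FinBij))).hom = _
    rw [F.functor.map_id]
    rfl
  map_mul' σ τ := by
    change (F.functor.map ((show (⟨m⟩ : FinBij) ⟶ ⟨m⟩ from τ) ≫
      (show (⟨m⟩ : FinBij) ⟶ ⟨m⟩ from σ))).hom = _
    rw [F.functor.map_comp]
    rfl

theorem naturality_apply {F G : SymSeq k} (f : F ⟶ G) {x y : FinBij} (σ : x ⟶ y)
    (v : F.functor.obj x) :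
    (f.natTrans.app y).hom ((F.functor.map σ).hom v) =
      (G.functor.map σ).hom ((f.natTrans.app x).hom v) :=
  congrArg (fun t => t.hom v) (f.natTrans.naturality σ)

/-- The images of a morphism in the various degrees. -/
def rangeFam {F G : SymSeq k} (f : G ⟶ F) (m : ℕ) : Subrepresentation (rep F m) where
  toSubmodule := LinearMap.range (f.natTrans.app ⟨m⟩).hom
  apply_mem_toSubmodule σ v := by
    rintro ⟨w, rfl⟩
    exact ⟨rep G m σ w, naturality_apply f (show (⟨m⟩ : FinBij) ⟶ ⟨m⟩ from σ) w⟩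

theorem rangeFam_comp_le {F G H : SymSeq k} (g : H ⟶ G) (f : G ⟶ F) :
    rangeFam (g ≫ f) ≤ rangeFam f := by
  rintro m v ⟨w, rfl⟩
  exact ⟨(g.natTrans.app ⟨m⟩).hom w, rfl⟩

/-- A morphism into the target of a monomorphism factors through it if its images in all degrees
are contained in those of the monomorphism. -/
theorem exists_fac_of_rangeFam_le {F G H : SymSeq k} (f : G ⟶ F) (i : H ⟶ F) [Mono i]
    (h : rangeFam f ≤ rangeFam i) : ∃ g : G ⟶ H, g ≫ i = f := by
  have hinj : ∀ x, Function.Injective (i.natTrans.app x).hom := fun x =>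
    (ModuleCat.mono_iff_injective _).mp (mono_app i x)
  let e : ∀ x, H.functor.obj x ≃ₗ[k] LinearMap.range (i.natTrans.app x).hom := fun x =>
    LinearEquiv.ofInjective _ (hinj x)
  let c : ∀ x, G.functor.obj x →ₗ[k] H.functor.obj x := fun x => (e x).symm.toLinearMap ∘ₗ
    LinearMap.codRestrict _ (f.natTrans.app x).hom fun w => h x.card ⟨w, rfl⟩
  have hc : ∀ x w, (i.natTrans.app x).hom (c x w) = (f.natTrans.app x).hom w := fun x w =>
    congrArg Subtype.val ((e x).apply_symm_apply
      (LinearMap.codRestrict _ (f.natTrans.app x).hom (fun w => h x.card ⟨w, rfl⟩) w))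
  refine ⟨⟨{ app := fun x => ModuleCat.ofHom (c x), naturality := fun x y σ => ?_ }⟩, ?_⟩
  · apply ModuleCat.hom_ext
    apply LinearMap.ext
    intro w
    apply hinj y
    change (i.natTrans.app y).hom (c y ((G.functor.map σ).hom w)) =
      (i.natTrans.app y).hom ((H.functor.map σ).hom (c x w))
    rw [hc, naturality_apply, naturality_apply, hc]
  · apply DayFunctor.hom_ext
    apply NatTrans.ext
    funext x
    apply ModuleCat.hom_ext
    exact LinearMap.ext (hc x)

theorem factors_iff_rangeFam_le {F G : SymSeq k} (U : Subobject F) (f : G ⟶ F) :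
    U.Factors f ↔ rangeFam f ≤ rangeFam U.arrow := by
  constructor
  · intro h
    conv_lhs => rw [← U.factorThru_arrow f h]
    exact rangeFam_comp_le _ _
  · intro h
    obtain ⟨g, rfl⟩ := exists_fac_of_rangeFam_le f U.arrow h
    exact Subobject.factors_comp_arrow g

section OfFam

variable {F : SymSeq k} (N : ∀ m, Subrepresentation (rep F m))

theorem map_mem_of_mem {x y : FinBij} (σ : x ⟶ y) {v : F.functor.obj x} (hv : v ∈ N x.card) :
    (F.functor.map σ).hom v ∈ N y.card := by
  obtain ⟨m⟩ := x
  obtain ⟨n⟩ := y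
  -- A morphism of `FinBij` exists only between equal cardinalities, so `σ` is a permutation.
  obtain rfl : m = n := Fin.equiv_iff_eq.mp ⟨σ⟩
  exact (N m).apply_mem_toSubmodule σ hv

/-- The object defined by a family of subrepresentations. -/
def ofFam : SymSeq k := ⟨{
  obj := fun x => ModuleCat.of k (N x.card).toSubmodule
  map := fun {x y} σ => ModuleCat.ofHom
    (LinearMap.restrict (p := (N x.card).toSubmodule) (q := (N y.card).toSubmodule)
      (F.functor.map σ).hom fun _ hv => map_mem_of_mem N σ hv)
  map_id := fun x => by
    apply ModuleCat.hom_ext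
    apply LinearMap.ext
    intro v
    apply Subtype.ext
    change (F.functor.map (𝟙 x)).hom v.1 = v.1
    rw [F.functor.map_id]
    rfl
  map_comp := fun σ τ => by
    apply ModuleCat.hom_ext
    apply LinearMap.ext
    intro v
    apply Subtype.ext
    change (F.functor.map (σ ≫ τ)).hom v.1 = (F.functor.map τ).hom ((F.functor.map σ).hom v.1)
    rw [F.functor.map_comp]
    rfl }⟩

/-- The inclusion of the object defined by a family of subrepresentations. -/
def ofFamι : ofFam N ⟶ F := ⟨{
  app := fun x => ModuleCat.ofHom (N x.card).toSubmodule.subtype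
  naturality := fun _ _ _ => rfl }⟩

instance : Mono (ofFamι N) := ⟨fun g h hgh => by
  apply DayFunctor.hom_ext
  apply NatTrans.ext
  funext x
  apply ModuleCat.hom_ext
  apply LinearMap.ext
  intro v
  apply Subtype.ext
  exact congrArg (fun t => (t.natTrans.app x).hom v) hgh⟩

theorem rangeFam_ofFamι : rangeFam (ofFamι N) = N := by
  funext m
  apply Subrepresentation.toSubmodule_injective
  exact Submodule.range_subtype _

end OfFam

/-- Subobjects are families of subrepresentations. -/
noncomputable def subobjectOrderIsoFam (F : SymSeq k) :
    Subobject F ≃o ∀ m, Subrepresentation (rep F m) where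
  toFun U := rangeFam U.arrow
  invFun N := Subobject.mk (ofFamι N)
  left_inv U := by
    apply le_antisymm
    · apply Subobject.mk_le_of_comm (Subobject.factorThru U (ofFamι _)
        ((factors_iff_rangeFam_le _ _).mpr (rangeFam_ofFamι _).le))
      exact Subobject.factorThru_arrow _ _ _
    · apply Subobject.le_of_factors
      rw [factors_iff_rangeFam_le]
      have h := (factors_iff_rangeFam_le _ _).mp
        (Subobject.mk_factors_self (ofFamι (rangeFam U.arrow)))
      rwa [rangeFam_ofFamι] at h
  right_inv N := by
    apply le_antisymm
    · change rangeFam (Subobject.mk (ofFamι N)).arrow ≤ N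
      rw [← Subobject.underlyingIso_hom_comp_eq_mk (ofFamι N)]
      exact (rangeFam_comp_le _ _).trans (rangeFam_ofFamι N).le
    · have h := (factors_iff_rangeFam_le _ _).mp (Subobject.mk_factors_self (ofFamι N))
      rwa [rangeFam_ofFamι] at h
  map_rel_iff' {U U'} := by
    change rangeFam U.arrow ≤ rangeFam U'.arrow ↔ _
    rw [← factors_iff_rangeFam_le]
    exact ⟨Subobject.le_of_factors, fun h => Subobject.factors_of_le _ h U.factors_self⟩

theorem factors_symm_subobjectOrderIsoFam {F G : SymSeq k} (N : ∀ m, Subrepresentation (rep F m))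
    (f : G ⟶ F) : ((subobjectOrderIsoFam F).symm N).Factors f ↔ rangeFam f ≤ N := by
  rw [factors_iff_rangeFam_le]
  change _ ≤ subobjectOrderIsoFam F _ ↔ _
  rw [OrderIso.apply_symm_apply]

end SymSeq

/-! ### The tensor algebra and its degree one component -/

namespace SymSeq

open DaySymm
open scoped TensorProduct

variable {k : Type u₁} [Field k]

/-- The projection of a sequence of representations to its component of degree `i`. -/
def degProj (F : SymSeq k) (i : ℕ) : F ⟶ F := ⟨{
  app := fun x => if x.card = i then 𝟙 _ else 0
  naturality := fun x y σ => by
    have h : x.card = y.card := Fin.equiv_iff_eq.mp ⟨σ⟩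
    rw [h]
    split_ifs <;> simp }⟩

theorem degProj_app (F : SymSeq k) (i : ℕ) (x : FinBij) :
    (degProj F i).natTrans.app x = if x.card = i then 𝟙 _ else 0 := rfl

theorem app_eq_zero_of_comp_degProj {F G : SymSeq k} {f : G ⟶ F} {i : ℕ}
    (h : f ≫ degProj F i = f) {x : FinBij} (hx : x.card ≠ i) : f.natTrans.app x = 0 := by
  rw [← h, DayFunctor.comp_natTrans, NatTrans.comp_app, degProj_app, if_neg hx, comp_zero]

variable (W : Type u₁) [AddCommGroup W] [Module k W]

theorem η_tensorHom_mul {X Y : SymSeq k} (p : X ⟶ tensorAlg k W) (v : Y ⟶ tensorAlg k W)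
    (x y : FinBij) :
    (DayFunctor.η X Y).app (x, y) ≫ ((p ⊗ₘ v) ≫ MonObj.mul).natTrans.app (x ⊗ y) =
      (p.natTrans.app x ⊗ₘ v.natTrans.app y) ≫
        Functor.LaxMonoidal.μ (tensorFunctor (k := k) W) x y := by
  change _ ≫ ((p ⊗ₘ v) ≫ laxMul _).natTrans.app _ = _
  rw [MonoidalCategory.tensorHom_def, Category.assoc, DayFunctor.comp_natTrans,
    DayFunctor.comp_natTrans, NatTrans.comp_app, NatTrans.comp_app]
  simp only [tensor_obj]
  rw [reassoc_of% η_whiskerRight, reassoc_of% η_whiskerLeft, η_laxMul,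
    MonoidalCategory.tensorHom_def, Category.assoc]

theorem ν_one : DayFunctor.ν FinBij (ModuleCat.{u₁} k) ≫
      (MonObj.one : _ ⟶ tensorAlg k W).natTrans.app (𝟙_ FinBij) =
      Functor.LaxMonoidal.ε (tensorFunctor (k := k) W) :=
  DayFunctor.ν_comp_unitDesc _

variable {W}

theorem one_comp_degProj :
    (MonObj.one : _ ⟶ tensorAlg k W) ≫ degProj _ 0 = MonObj.one := by
  apply DayFunctor.unit_hom_ext
  rw [DayFunctor.comp_natTrans, NatTrans.comp_app, degProj_app,
    if_pos (show (𝟙_ FinBij).card = 0 from rfl), Category.comp_id]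

/-- Being concentrated in degree `i` is expressed by invariance under `degProj _ i`; the lemma says
that degrees add under multiplication. -/
theorem tensorHom_mul_comp_degProj {X Y : SymSeq k} {p : X ⟶ tensorAlg k W}
    {v : Y ⟶ tensorAlg k W} {i j : ℕ} (hp : p ≫ degProj _ i = p) (hv : v ≫ degProj _ j = v) :
    ((p ⊗ₘ v) ≫ MonObj.mul) ≫ degProj _ (i + j) = (p ⊗ₘ v) ≫ MonObj.mul := by
  apply DayFunctor.tensor_hom_ext
  intro x y
  rw [DayFunctor.comp_natTrans, NatTrans.comp_app, reassoc_of% η_tensorHom_mul, η_tensorHom_mul,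
    degProj_app]
  by_cases hx : x.card = i
  · by_cases hy : y.card = j
    · rw [if_pos (show (x ⊗ y).card = i + j from congrArg₂ (· + ·) hx hy), Category.comp_id]
    · rw [app_eq_zero_of_comp_degProj hv hy]
      simp
  · rw [app_eq_zero_of_comp_degProj hp hx]
    simp

theorem powToAlg_comp_degProj {X : SymSeq k} {v : X ⟶ tensorAlg k W}
    (hv : v ≫ degProj _ 1 = v) (i : ℕ) :
    powToAlg v i ≫ degProj _ i = powToAlg v i := by
  induction i with
  | zero => exact one_comp_degProj
  | succ i ih => exact tensorHom_mul_comp_degProj ih hv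

theorem concat_surjective (a b : ℕ) : Function.Surjective (concat (k := k) W a b) :=
  (PiTensorProduct.reindex k (fun _ => W) finSumFinEquiv).surjective.comp
    (PiTensorProduct.tmulEquiv k W).surjective

/-- Concatenation is surjective, so every degree is reached by products of elements of degree one;
the empty product spans degree zero. -/
theorem powToAlg_surjective {X : SymSeq k} {v : X ⟶ tensorAlg k W}
    (hv : Function.Surjective (v.natTrans.app ⟨1⟩).hom) (i : ℕ) :
    Function.Surjective ((powToAlg v i).natTrans.app ⟨i⟩).hom := by
  induction i with
  | zero =>
    have h := congrArg (fun t => (ModuleCat.Hom.hom t)) (ν_one (k := k) W)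
    have hs : Function.Surjective
        (Functor.LaxMonoidal.ε (tensorFunctor (k := k) W)).hom := by
      intro x
      change (⨂[k] (_ : Fin 0), W) at x
      induction x using PiTensorProduct.induction_on with
      | smul_tprod r f =>
        refine ⟨r, ?_⟩
        change r • PiTensorProduct.tprod k (fun i : Fin 0 => i.elim0) = _
        congr 2
        exact Subsingleton.elim _ _
      | add x y hx hy =>
        obtain ⟨a, rfl⟩ := hx
        obtain ⟨b, rfl⟩ := hy
        exact ⟨a + b, map_add _ _ _⟩
    rw [← h] at hs
    exact Function.Surjective.of_comp hs
  | succ i ih =>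
    have h := congrArg (fun t => (ModuleCat.Hom.hom t)) (η_tensorHom_mul W (powToAlg v i) v ⟨i⟩ ⟨1⟩)
    have hs : Function.Surjective (concat (k := k) W i 1 ∘ₗ
        TensorProduct.map ((powToAlg v i).natTrans.app ⟨i⟩).hom (v.natTrans.app ⟨1⟩).hom) :=
      (concat_surjective i 1).comp (TensorProduct.map_surjective ih hv)
    have hs' : Function.Surjective (ModuleCat.Hom.hom
      (((powToAlg v i).natTrans.app ⟨i⟩ ⊗ₘ v.natTrans.app ⟨1⟩) ≫
        Functor.LaxMonoidal.μ (tensorFunctor (k := k) W) ⟨i⟩ ⟨1⟩)) := hs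
    rw [← h] at hs'
    exact Function.Surjective.of_comp hs'

variable (k W)

/-- The component of degree one of the tensor algebra, as a subobject. -/
noncomputable def degOne : Subobject (tensorAlg k W) :=
  (subobjectOrderIsoFam _).symm fun m => if m = 1 then ⊤ else ⊥

theorem rangeFam_degOne (m : ℕ) :
    rangeFam (degOne k W).arrow m = if m = 1 then ⊤ else ⊥ :=
  congrFun ((subobjectOrderIsoFam (tensorAlg k W)).apply_symm_apply _) m

theorem degOne_surjective : Function.Surjective ((degOne k W).arrow.natTrans.app ⟨1⟩).hom := by
  intro x
  have h : x ∈ rangeFam (degOne k W).arrow 1 := by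
    rw [rangeFam_degOne]
    trivial
  exact h

theorem degOne_comp_degProj : (degOne k W).arrow ≫ degProj _ 1 = (degOne k W).arrow := by
  apply DayFunctor.hom_ext
  apply NatTrans.ext
  funext x
  rw [DayFunctor.comp_natTrans, NatTrans.comp_app, degProj_app]
  split_ifs with hx
  · rw [Category.comp_id]
  · rw [comp_zero]
    apply ModuleCat.hom_ext
    apply LinearMap.ext
    intro w
    have h : ((degOne k W).arrow.natTrans.app x).hom w ∈
        rangeFam (degOne k W).arrow x.card := ⟨w, rfl⟩
    rw [rangeFam_degOne, if_neg hx] at h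
    exact ((Submodule.mem_bot k).mp h).symm

theorem rangeFam_powToAlg_degOne_le (i n : ℕ) (h : i ≤ n) :
    rangeFam (powToAlg (degOne k W).arrow i) ≤
      truncTop (fun m => Subrepresentation (rep (tensorAlg k W) m)) n := by
  intro m
  unfold truncTop
  split_ifs with hm
  · exact le_top
  · rintro _ ⟨w, rfl⟩
    have := app_eq_zero_of_comp_degProj (powToAlg_comp_degProj (degOne_comp_degProj k W) i)
      (x := ⟨m⟩) (show m ≠ i by omega)
    rw [this]
    exact Submodule.zero_mem _

/-- The filtration of the tensor algebra defined by its component of degree one is the filtration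
by the degree. -/
theorem genFiltration_degOne (n : ℕ) :
    genFiltration (degOne k W) n = (subobjectOrderIsoFam _).symm
      (truncTop (fun m => Subrepresentation (rep (tensorAlg k W) m)) n) := by
  apply le_antisymm
  · rw [genFiltration_le_iff]
    intro i hi
    rw [factors_symm_subobjectOrderIsoFam]
    exact rangeFam_powToAlg_degOne_le k W i n hi
  · rw [← OrderIso.le_symm_apply, OrderIso.symm_symm]
    intro m
    unfold truncTop
    split_ifs with hm
    · have h := (factors_iff_rangeFam_le _ _).mp (genFiltration_factors (degOne k W) hm) m
      refine le_trans (fun x _ => ?_) h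
      exact powToAlg_surjective (degOne_surjective k W) m x
    · exact bot_le

theorem generates_degOne : Generates (degOne k W) := by
  apply generates_of_forall_eq_zero
  intro Z f h
  apply DayFunctor.hom_ext
  apply NatTrans.ext
  funext ⟨n⟩
  apply ModuleCat.hom_ext
  apply LinearMap.ext
  intro x
  obtain ⟨y, rfl⟩ := powToAlg_surjective (degOne_surjective k W) n x
  exact congrArg (fun t => (t.natTrans.app ⟨n⟩).hom y) (h n)

theorem growth_degOne_eq_height (n : ℕ) :
    growth (degOne k W) n =
      Order.height (truncTop (fun m => Subrepresentation (rep (tensorAlg k W) m)) n) := by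
  unfold growth
  rw [objLength_eq_height, genFiltration_degOne, Order.height_orderIso]

/-- The growth of the tensor algebra with respect to its component of degree one. -/
theorem growth_degOne
    (h : ∀ m, Order.height (⊤ : Subrepresentation (rep (tensorAlg k W) m)) ≠ ⊤) (n : ℕ) :
    growth (degOne k W) n = ∑ m ∈ Finset.range (n + 1),
      Order.height (⊤ : Subrepresentation (rep (tensorAlg k W) m)) := by
  rw [growth_degOne_eq_height]
  exact le_antisymm (height_truncTop_le h n) (le_height_truncTop n)

/-- Finite length is inherited from the first step of the filtration, which contains `degOne` and
whose length is already computed. -/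
theorem isFiniteLengthGenerating_degOne
    (h : ∀ m, Order.height (⊤ : Subrepresentation (rep (tensorAlg k W) m)) ≠ ⊤) :
    IsFiniteLengthGenerating (degOne k W) := by
  refine ⟨?_, generates_degOne k W⟩
  have h₁ : degOne k W ≤ genFiltration (degOne k W) 1 := by
    rw [genFiltration_degOne, degOne, OrderIso.le_iff_le]
    intro m
    unfold truncTop
    beta_reduce
    by_cases hm : m = 1
    · rw [if_pos (hm.le : m ≤ 1)]
      exact le_top
    · rw [if_neg hm]
      exact bot_le
  have h₂ := growth_degOne k W h 1
  unfold growth at h₂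
  rw [objLength_eq_height] at h₂ ⊢
  have h₃ := Order.height_mono h₁
  rw [h₂] at h₃
  refine ne_top_of_le_ne_top ?_ h₃
  exact (ENat.sum_lt_top.mpr fun m _ => lt_top_iff_ne_top.mpr (h m)).ne

end SymSeq

/-! ### Matrices indexed by words that are invariant under permutations of the positions -/

namespace WordMatrix

open Finset

variable {m d : ℕ}

/-- The number of positions where the letters of the two words are `i` and `j`. -/
def cnt (x y : Fin m → Fin d) (i j : Fin d) : ℕ := #{p | x p = i ∧ y p = j}

/-- The number of occurrences of each letter. -/
def wt (x : Fin m → Fin d) (i : Fin d) : ℕ := #{p | x p = i}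

theorem cnt_comm (x y : Fin m → Fin d) (i j : Fin d) : cnt x y i j = cnt y x j i := by
  simp only [cnt, and_comm]

theorem wt_eq_sum_cnt_left (x y : Fin m → Fin d) (i : Fin d) : wt x i = ∑ j, cnt x y i j := by
  unfold wt cnt
  rw [card_eq_sum_card_fiberwise (f := y) (t := univ) (by simp)]
  simp only [filter_filter]

theorem wt_eq_sum_cnt_right (x y : Fin m → Fin d) (j : Fin d) : wt y j = ∑ i, cnt x y i j := by
  rw [wt_eq_sum_cnt_left y x]
  exact sum_congr rfl fun i _ => cnt_comm _ _ _ _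

theorem wt_left_eq_of_cnt_eq {x y x' y' : Fin m → Fin d} (h : cnt x y = cnt x' y') :
    wt x = wt x' := by
  funext i
  rw [wt_eq_sum_cnt_left x y, wt_eq_sum_cnt_left x' y', h]

theorem wt_right_eq_of_cnt_eq {x y x' y' : Fin m → Fin d} (h : cnt x y = cnt x' y') :
    wt y = wt y' := by
  funext i
  rw [wt_eq_sum_cnt_right x y, wt_eq_sum_cnt_right x' y', h]

/-- The matrix `cnt x y` records which pairs of letters occur, so positionwise properties of pairs
carry over. This is the main tool of `mid_dichotomy`. -/
theorem forall_of_cnt_eq {x y x' y' : Fin m → Fin d} (h : cnt x y = cnt x' y')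
    {P : Fin d → Fin d → Prop} (hP : ∀ p, P (x p) (y p)) (p : Fin m) : P (x' p) (y' p) := by
  have h₁ : 0 < cnt x' y' (x' p) (y' p) := card_pos.mpr ⟨p, by simp⟩
  rw [← h] at h₁
  obtain ⟨q, hq⟩ := card_pos.mp h₁
  rw [mem_filter] at hq
  rw [← hq.2.1, ← hq.2.2]
  exact hP q

theorem cnt_comp_perm (x y : Fin m → Fin d) (σ : Equiv.Perm (Fin m)) :
    cnt (x ∘ σ) (y ∘ σ) = cnt x y := by
  funext i j
  exact card_bij (fun p _ => σ p) (by simp) (by simp)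
    fun p hp => ⟨σ.symm p, by simpa using hp, by simp⟩

theorem exists_perm_of_card_fiber_eq {α : Type*} [DecidableEq α] {f g : Fin m → α}
    (h : ∀ a, #{p | f p = a} = #{p | g p = a}) : ∃ σ : Equiv.Perm (Fin m), g = f ∘ σ := by
  have h' : ∀ a, Nonempty ({p // g p = a} ≃ {p // f p = a}) := fun a => by
    refine ⟨Fintype.equivOfCardEq ?_⟩
    rw [Fintype.card_subtype, Fintype.card_subtype, h]
  let e := fun a => (h' a).some
  refine ⟨(Equiv.sigmaFiberEquiv g).symm.trans
    ((Equiv.sigmaCongrRight e).trans (Equiv.sigmaFiberEquiv f)), ?_⟩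
  funext p
  exact ((e (g p)) ⟨p, rfl⟩).2.symm

/-- This classifies the orbits of the symmetric group on pairs of words: `cnt` is a complete
invariant, since it gives the fibre sizes of `p ↦ (x p, y p)`. -/
theorem exists_perm_of_cnt_eq {x y x' y' : Fin m → Fin d} (h : cnt x y = cnt x' y') :
    ∃ σ : Equiv.Perm (Fin m), x' = x ∘ σ ∧ y' = y ∘ σ := by
  obtain ⟨σ, hσ⟩ := exists_perm_of_card_fiber_eq (f := fun p => (x p, y p))
    (g := fun p => (x' p, y' p)) (fun a => by
      have := congrFun (congrFun h a.1) a.2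
      simp only [cnt] at this
      simp only [Prod.ext_iff]
      exact this)
  exact ⟨σ, funext fun p => (Prod.ext_iff.mp (congrFun hσ p)).1,
    funext fun p => (Prod.ext_iff.mp (congrFun hσ p)).2⟩

variable (m d) in
/-- The algebra of the matrices that are invariant under permutations of the positions. -/
def invAlg (R : Type*) [CommRing R] : Subalgebra R (Matrix (Fin m → Fin d) (Fin m → Fin d) R) where
  carrier := {a | ∀ (σ : Equiv.Perm (Fin m)) x y, a (x ∘ σ) (y ∘ σ) = a x y}
  mul_mem' {a b} ha hb σ x y := by
    rw [Matrix.mul_apply, Matrix.mul_apply]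
    rw [← Equiv.sum_comp (σ.symm.arrowCongr (Equiv.refl (Fin d)))]
    refine sum_congr rfl fun z _ => ?_
    rw [← ha σ x z, ← hb σ z y]
    rfl
  add_mem' ha hb σ x y := by
    rw [Matrix.add_apply, Matrix.add_apply, ha, hb]
  algebraMap_mem' r σ x y := by
    rw [Matrix.algebraMap_matrix_apply, Matrix.algebraMap_matrix_apply]
    simp [σ.surjective.injective_comp_right.eq_iff]

section CommRing

variable {R : Type*} [CommRing R]

theorem transpose_mem_invAlg {a : Matrix (Fin m → Fin d) (Fin m → Fin d) R}
    (ha : a ∈ invAlg m d R) : a.transpose ∈ invAlg m d R := fun σ x y => ha σ y x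

theorem apply_eq_of_cnt_eq {a : Matrix (Fin m → Fin d) (Fin m → Fin d) R}
    (ha : a ∈ invAlg m d R) {x y x' y' : Fin m → Fin d} (h : cnt x y = cnt x' y') :
    a x y = a x' y' := by
  obtain ⟨σ, rfl, rfl⟩ := exists_perm_of_cnt_eq h
  exact (ha σ x y).symm

variable (m R) in
/-- The indicator matrix of an orbit of pairs of words. -/
def orbMat (A : Fin d → Fin d → ℕ) : Matrix (Fin m → Fin d) (Fin m → Fin d) R :=
  Matrix.of fun x y => if cnt x y = A then 1 else 0

theorem orbMat_apply (A : Fin d → Fin d → ℕ) (x y : Fin m → Fin d) :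
    orbMat m R A x y = if cnt x y = A then 1 else 0 := rfl

theorem orbMat_mem (A : Fin d → Fin d → ℕ) : orbMat m R A ∈ invAlg m d R := fun σ x y => by
  rw [orbMat_apply, orbMat_apply, cnt_comp_perm]

theorem eq_sum_orbMat {a : Matrix (Fin m → Fin d) (Fin m → Fin d) R} (ha : a ∈ invAlg m d R) :
    ∃ f : (Fin d → Fin d → ℕ) → R, (∀ x y, f (cnt x y) = a x y) ∧
      a = ∑ A ∈ univ.image fun p : (Fin m → Fin d) × (Fin m → Fin d) => cnt p.1 p.2,
        f A • orbMat m R A := by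
  classical
  -- The value `0` at matrices that do not occur as counts is arbitrary.
  let f : (Fin d → Fin d → ℕ) → R := fun A =>
    if h : ∃ x y : Fin m → Fin d, cnt x y = A then a h.choose h.choose_spec.choose else 0
  have hf : ∀ x y, f (cnt x y) = a x y := fun x y => by
    have h : ∃ x' y' : Fin m → Fin d, cnt x' y' = cnt x y := ⟨x, y, rfl⟩
    simp only [f, dif_pos h]
    exact apply_eq_of_cnt_eq ha h.choose_spec.choose_spec
  refine ⟨f, hf, ?_⟩
  ext x y
  rw [Matrix.sum_apply, sum_eq_single (cnt x y)]
  · simp [orbMat_apply, hf]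
  · intro A _ hA
    simp [orbMat_apply, hA.symm]
  · intro h
    exact absurd (mem_image.mpr ⟨(x, y), mem_univ _, rfl⟩) h

/-- Only the orbits in the support of `a` have to be checked; this is what makes a triangular
induction over the orbits possible. -/
theorem mem_of_orbMat_mem {a : Matrix (Fin m → Fin d) (Fin m → Fin d) R} (ha : a ∈ invAlg m d R)
    (S : Submodule R (Matrix (Fin m → Fin d) (Fin m → Fin d) R))
    (h : ∀ x y, a x y ≠ 0 → orbMat m R (cnt x y) ∈ S) : a ∈ S := by
  obtain ⟨f, hf, hs⟩ := eq_sum_orbMat ha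
  rw [hs]
  refine S.sum_mem fun A hA => ?_
  obtain ⟨⟨x, y⟩, -, rfl⟩ := mem_image.mp hA
  by_cases h0 : a x y = 0
  · rw [hf, h0, zero_smul]
    exact S.zero_mem
  · exact S.smul_mem _ (h x y h0)

variable (m R) in
/-- The projection to the span of the words of a given weight. -/
def wtProj (lam : Fin d → ℕ) : Matrix (Fin m → Fin d) (Fin m → Fin d) R :=
  Matrix.diagonal fun x => if wt x = lam then 1 else 0

theorem wt_comp_perm (x : Fin m → Fin d) (σ : Equiv.Perm (Fin m)) : wt (x ∘ σ) = wt x :=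
  wt_left_eq_of_cnt_eq (cnt_comp_perm x x σ)

theorem wtProj_mem (lam : Fin d → ℕ) : wtProj m R lam ∈ invAlg m d R := fun σ x y => by
  unfold wtProj
  rw [Matrix.diagonal_apply, Matrix.diagonal_apply, wt_comp_perm]
  simp [σ.surjective.injective_comp_right.eq_iff]

theorem cnt_eq_cnt_self_iff (x x' y' : Fin m → Fin d) :
    cnt x' y' = cnt x x ↔ x' = y' ∧ wt x' = wt x := by
  constructor
  · intro h
    exact ⟨funext (forall_of_cnt_eq h.symm (P := fun a b => a = b) fun _ => rfl),
      wt_left_eq_of_cnt_eq h⟩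
  · rintro ⟨rfl, h⟩
    funext i j
    by_cases hij : i = j
    · subst hij
      have := congrFun h i
      simpa [cnt, wt] using this
    · have : ∀ z : Fin m → Fin d, cnt z z i j = 0 := fun z => by
        rw [cnt, card_eq_zero, filter_eq_empty_iff]
        rintro p - ⟨h₁, h₂⟩
        exact hij (h₁.symm.trans h₂)
      rw [this, this]

theorem orbMat_self (x : Fin m → Fin d) : orbMat m R (cnt x x) = wtProj m R (wt x) := by
  ext x' y'
  rw [orbMat_apply, wtProj, Matrix.diagonal_apply]
  simp only [cnt_eq_cnt_self_iff, ite_and]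

theorem wtProj_mul_orbMat (x y : Fin m → Fin d) (lam : Fin d → ℕ) :
    wtProj m R lam * orbMat m R (cnt x y) =
      if wt x = lam then orbMat m R (cnt x y) else 0 := by
  ext x' y'
  rw [wtProj, Matrix.diagonal_mul, orbMat_apply]
  by_cases h : cnt x' y' = cnt x y
  · rw [wt_left_eq_of_cnt_eq h]
    split_ifs <;> simp [orbMat_apply, h]
  · split_ifs <;> simp [orbMat_apply, h]

theorem orbMat_mul_wtProj (x y : Fin m → Fin d) (lam : Fin d → ℕ) :
    orbMat m R (cnt x y) * wtProj m R lam =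
      if wt y = lam then orbMat m R (cnt x y) else 0 := by
  ext x' y'
  rw [wtProj, Matrix.mul_diagonal, orbMat_apply]
  by_cases h : cnt x' y' = cnt x y
  · rw [wt_right_eq_of_cnt_eq h]
    split_ifs <;> simp [orbMat_apply, h]
  · split_ifs <;> simp [orbMat_apply, h]

theorem sum_wtProj :
    ∑ lam ∈ univ.image (wt : (Fin m → Fin d) → Fin d → ℕ), wtProj m R lam = 1 := by
  ext x y
  rw [Matrix.sum_apply, sum_eq_single (wt x)]
  · simp [wtProj, Matrix.diagonal_apply, Matrix.one_apply]
  · intro lam _ h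
    simp [wtProj, Matrix.diagonal_apply, h.symm]
  · intro h
    exact absurd (mem_image_of_mem _ (mem_univ x)) h

end CommRing

/-! #### Factorization of an orbit matrix through a larger weight -/

/-- The word that has the letter `i` where one of the two words has it, and that agrees with the
first word at the other positions. -/
def mid (i : Fin d) (x y : Fin m → Fin d) (p : Fin m) : Fin d :=
  if x p = i ∨ y p = i then i else x p

/-- Through `mid i x y` all entries of `cnt x y` except the one at `(i, i)` can be read off from the
two factors. That entry is controlled by inclusion-exclusion in the next lemma. -/
theorem cnt_eq_of_mid (i : Fin d) (x y : Fin m → Fin d) (a b : Fin d) (hab : ¬ (a = i ∧ b = i)) :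
    cnt x y a b = if b = i then cnt x (mid i x y) a i else cnt (mid i x y) y a b := by
  split_ifs with hb
  · unfold cnt mid
    congr 1
    ext p
    simp only [mem_filter, mem_univ, true_and]
    grind
  · unfold cnt mid
    congr 1
    ext p
    simp only [mem_filter, mem_univ, true_and]
    grind

theorem card_inter_add_card_union (i : Fin d) (x y : Fin m → Fin d) :
    cnt x y i i + #{p | x p = i ∨ y p = i} = wt x i + wt y i := by
  unfold cnt wt
  rw [filter_and, filter_or, add_comm, card_union_add_card_inter]

theorem wt_mid (i : Fin d) (x y : Fin m → Fin d) :
    wt (mid i x y) i = #{p | x p = i ∨ y p = i} := by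
  unfold wt mid
  congr 1
  ext p
  simp only [mem_filter, mem_univ, true_and]
  grind

/-- Here `z'` runs over the words contributing to the product of the two orbit matrices at `(x',
y')`. It has the letter `i` wherever `x'` or `y'` does, and the number of such positions is
prescribed; by inclusion-exclusion `cnt x' y' i i` is at least `cnt x y i i`, with equality only if
`z'` has no further `i`. Smaller letters occupy the same positions in all words, so the earlier
diagonal entries agree. -/
theorem mid_dichotomy {i : Fin d} {x y : Fin m → Fin d}
    (hmin : ∀ j < i, ∀ p, x p = j ↔ y p = j) {x' y' z' : Fin m → Fin d}
    (h₁ : cnt x' z' = cnt x (mid i x y)) (h₂ : cnt z' y' = cnt (mid i x y) y) :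
    (cnt x' y' = cnt x y ∧ z' = mid i x' y') ∨
      toLex (fun j => cnt x y j j) < toLex (fun j => cnt x' y' j j) := by
  have a₁ : ∀ p, x' p = i → z' p = i :=
    forall_of_cnt_eq h₁.symm (P := fun a b => a = i → b = i) fun p h => by simp [mid, h]
  have a₂ : ∀ p, y' p = i → z' p = i :=
    forall_of_cnt_eq h₂.symm (P := fun a b => b = i → a = i) fun p h => by simp [mid, h]
  have a₃ : ∀ p, z' p ≠ i → z' p = x' p :=
    forall_of_cnt_eq h₁.symm (P := fun a b => b ≠ i → b = a) fun p h => by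
      unfold mid at h ⊢
      split_ifs at h ⊢ with h'
      · exact absurd rfl h
      · rfl
  have a₄ : ∀ p, ∀ j < i, x' p = j ↔ z' p = j :=
    forall_of_cnt_eq h₁.symm (P := fun a b => ∀ j < i, a = j ↔ b = j) fun p j hj => by
      have := hmin j hj p
      unfold mid
      split_ifs with h'
      · grind
      · rfl
  have a₅ : ∀ p, ∀ j < i, z' p = j ↔ y' p = j :=
    forall_of_cnt_eq h₂.symm (P := fun a b => ∀ j < i, a = j ↔ b = j) fun p j hj => by
      have := hmin j hj p
      unfold mid
      split_ifs with h'
      · grind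
      · exact this
  have w₁ : wt x' = wt x := wt_left_eq_of_cnt_eq h₁
  have w₂ : wt y' = wt y := wt_right_eq_of_cnt_eq h₂
  have w₃ : wt z' = wt (mid i x y) := wt_left_eq_of_cnt_eq h₂
  have hdiag : ∀ j < i, cnt x y j j = cnt x' y' j j := by
    intro j hj
    have e : ∀ u v : Fin m → Fin d, (∀ p, u p = j ↔ v p = j) → cnt u v j j = wt u j := by
      intro u v huv
      unfold cnt wt
      congr 1
      ext p
      simp [← huv p]
    rw [e x y (hmin j hj), e x' y' fun p => (a₄ p j hj).trans (a₅ p j hj), w₁]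
  have hsub : (univ.filter fun p => x' p = i ∨ y' p = i) ⊆ univ.filter fun p => z' p = i := by
    intro p hp
    simp only [mem_filter, mem_univ, true_and] at hp ⊢
    exact hp.elim (a₁ p) (a₂ p)
  have hcard : #{p | z' p = i} = #{p | x p = i ∨ y p = i} :=
    (congrFun w₃ i).trans (wt_mid i x y)
  have c₁ := card_inter_add_card_union i x y
  have c₂ := card_inter_add_card_union i x' y'
  have c₃ := card_le_card hsub
  rw [w₁, w₂] at c₂
  rcases lt_or_ge (cnt x y i i) (cnt x' y' i i) with hlt | hge
  · exact Or.inr ⟨i, hdiag, hlt⟩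
  · left
    -- By `c₁` and `c₂` with equal weights, `hge` says that the union for `x'`, `y'` is at least as
    -- large as that for `x`, `y`, whose size is that of the set on the right.
    have heq := eq_of_subset_of_card_le hsub (by omega)
    have hz : z' = mid i x' y' := by
      funext p
      unfold mid
      split_ifs with h
      · exact h.elim (a₁ p) (a₂ p)
      · apply a₃
        intro hzp
        have : p ∈ univ.filter fun p => z' p = i := by simp [hzp]
        rw [← heq] at this
        simp only [mem_filter, mem_univ, true_and] at this
        exact h this
    refine ⟨?_, hz⟩
    funext a b
    by_cases hab : a = i ∧ b = i
    · rw [hab.1, hab.2]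
      omega
    · rw [cnt_eq_of_mid i x y a b hab, cnt_eq_of_mid i x' y' a b hab, ← hz, h₁, h₂]

theorem mid_comp_perm (i : Fin d) (x y : Fin m → Fin d) (σ : Equiv.Perm (Fin m)) :
    mid i (x ∘ σ) (y ∘ σ) = mid i x y ∘ σ := rfl

/-- Letters below `i` keep their positions and `i` gains some. The gain is strict because `i` occurs
equally often in both words, but at different positions. -/
theorem toLex_wt_lt_wt_mid {i : Fin d} {x y : Fin m → Fin d} (hxy : wt x = wt y)
    (hmin : ∀ j < i, ∀ p, x p = j ↔ y p = j) (hi : ¬ ∀ p, x p = i ↔ y p = i) :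
    toLex (wt x) < toLex (wt (mid i x y)) := by
  refine ⟨i, fun j hj => ?_, ?_⟩
  · change wt x j = wt (mid i x y) j
    unfold wt mid
    congr 1
    ext p
    have := hmin j hj p
    simp only [mem_filter, mem_univ, true_and]
    grind
  · change wt x i < wt (mid i x y) i
    rw [wt_mid]
    have hs : (univ.filter fun p => x p = i) ⊆ univ.filter fun p => x p = i ∨ y p = i :=
      fun p hp => by
        simp only [mem_filter, mem_univ, true_and] at hp ⊢
        exact Or.inl hp
    have ht : (univ.filter fun p => y p = i) ⊆ univ.filter fun p => x p = i ∨ y p = i :=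
      fun p hp => by
        simp only [mem_filter, mem_univ, true_and] at hp ⊢
        exact Or.inr hp
    refine lt_of_le_of_ne (card_le_card hs) fun h => hi ?_
    have e₁ := eq_of_subset_of_card_le hs h.ge
    have e₂ := eq_of_subset_of_card_le ht (by
      have := congrFun hxy i
      unfold wt at this h
      omega)
    intro p
    have := congrArg (fun s => p ∈ s) (e₁.trans e₂.symm)
    simpa using this

variable {R : Type*} [CommRing R]

theorem orbMat_mul_orbMat_apply (A B : Fin d → Fin d → ℕ) (x y : Fin m → Fin d) :
    (orbMat m R A * orbMat m R B) x y = #{z | cnt x z = A ∧ cnt z y = B} := by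
  rw [Matrix.mul_apply]
  simp only [orbMat_apply, mul_ite, mul_one, mul_zero, ← ite_and]
  rw [sum_boole]
  simp only [and_comm]

/-- The product counts intermediate words. Away from larger diagonals there is exactly one on the
orbit of `(x, y)`, namely `mid`, and none elsewhere, so the difference vanishes there. -/
theorem exists_gt_of_mid_ne_zero {i : Fin d} {x y : Fin m → Fin d}
    (hmin : ∀ j < i, ∀ p, x p = j ↔ y p = j) {x' y' : Fin m → Fin d}
    (h : (orbMat m R (cnt x (mid i x y)) * orbMat m R (cnt (mid i x y) y) -
      orbMat m R (cnt x y)) x' y' ≠ 0) :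
    toLex (fun j => cnt x y j j) < toLex (fun j => cnt x' y' j j) := by
  by_contra hlt
  apply h
  rw [Matrix.sub_apply, orbMat_mul_orbMat_apply, orbMat_apply, sub_eq_zero]
  split_ifs with hc
  · have : (univ.filter fun z => cnt x' z = cnt x (mid i x y) ∧ cnt z y' = cnt (mid i x y) y) =
        {mid i x' y'} := by
      ext z
      simp only [mem_filter, mem_univ, true_and, mem_singleton]
      constructor
      · rintro ⟨h₁, h₂⟩
        rcases mid_dichotomy hmin h₁ h₂ with h | h
        · exact h.2
        · exact absurd h hlt
      · rintro rfl
        obtain ⟨σ, rfl, rfl⟩ := exists_perm_of_cnt_eq hc.symm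
        rw [mid_comp_perm, cnt_comp_perm, cnt_comp_perm]
        exact ⟨rfl, rfl⟩
    rw [this, card_singleton, Nat.cast_one]
  · have : (univ.filter fun z => cnt x' z = cnt x (mid i x y) ∧ cnt z y' = cnt (mid i x y) y) =
        ∅ := by
      rw [filter_eq_empty_iff]
      rintro z - ⟨h₁, h₂⟩
      rcases mid_dichotomy hmin h₁ h₂ with h | h
      · exact hc h.1
      · exact hlt h
    rw [this, card_empty, Nat.cast_zero]

/-- Let `e = u v`, where `u` and `v` factor through the weight `lam` and `v` vanishes in all larger
weights. Then `u a v` is a multiple of `e` for all invariant matrices `a`. -/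
theorem mul_mul_mem_span {lam : Fin d → ℕ} {u v : Matrix (Fin m → Fin d) (Fin m → Fin d) R}
    (hu : u * wtProj m R lam = u) (hv : wtProj m R lam * v = v)
    (hgt : ∀ mu : Fin d → ℕ, toLex lam < toLex mu → ∀ s ∈ invAlg m d R, wtProj m R mu * s * v = 0)
    {a : Matrix (Fin m → Fin d) (Fin m → Fin d) R} (ha : a ∈ invAlg m d R) :
    u * a * v ∈ Submodule.span R {u * v} := by
  let S : Submodule R (Matrix (Fin m → Fin d) (Fin m → Fin d) R) :=
    (Submodule.span R {u * v}).comap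
      (LinearMap.mulRight R v ∘ₗ LinearMap.mulLeft R u)
  have hS : ∀ a, a ∈ S ↔ u * a * v ∈ Submodule.span R {u * v} := fun a => Iff.rfl
  rw [← hS]
  apply mem_of_orbMat_mem ha
  intro x y _
  -- Downward induction on the lexicographic order of the diagonals of the count matrices; it is
  -- well founded since there are finitely many pairs of words.
  let r : (Fin m → Fin d) × (Fin m → Fin d) → (Fin m → Fin d) × (Fin m → Fin d) → Prop :=
    fun p q => toLex (fun j => cnt q.1 q.2 j j) < toLex (fun j => cnt p.1 p.2 j j)
  have hwf : WellFounded r := by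
    have : IsTrans _ r := ⟨fun _ _ _ h₁ h₂ => lt_trans h₂ h₁⟩
    have : Std.Irrefl r := ⟨fun _ h => lt_irrefl _ h⟩
    exact Finite.wellFounded_of_trans_of_irrefl r
  suffices ∀ p : (Fin m → Fin d) × (Fin m → Fin d), orbMat m R (cnt p.1 p.2) ∈ S from this (x, y)
  intro p
  induction p using hwf.induction with
  | _ p ih =>
  obtain ⟨x, y⟩ := p
  dsimp only at ih ⊢
  by_cases hx : wt x = lam
  swap
  · have h : u * orbMat m R (cnt x y) = 0 := by
      rw [← hu, mul_assoc, wtProj_mul_orbMat, if_neg hx, mul_zero]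
    rw [hS, h, zero_mul]
    exact Submodule.zero_mem _
  by_cases hy : wt y = lam
  swap
  · have h : orbMat m R (cnt x y) * v = 0 := by
      rw [← hv, ← mul_assoc, orbMat_mul_wtProj, if_neg hy, zero_mul]
    rw [hS, mul_assoc, h, mul_zero]
    exact Submodule.zero_mem _
  by_cases hxy : x = y
  · rw [hS, ← hxy, orbMat_self, hx, hu]
    exact Submodule.mem_span_singleton_self _
  -- The smallest letter whose positions in the two words differ.
  obtain ⟨i, hi, hmin⟩ : ∃ i : Fin d, (¬ ∀ p, x p = i ↔ y p = i) ∧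
      ∀ j < i, ∀ p, x p = j ↔ y p = j := by
    have hne : {i : Fin d | ¬ ∀ p, x p = i ↔ y p = i}.Nonempty := by
      by_contra hne
      rw [Set.not_nonempty_iff_eq_empty, Set.eq_empty_iff_forall_notMem] at hne
      refine hxy (funext fun p => ?_)
      have := hne (x p)
      simp only [Set.mem_ofPred_eq, not_not] at this
      exact ((this p).mp rfl).symm
    obtain ⟨i, hi, hmin⟩ := (wellFounded_lt (α := Fin d)).has_min _ hne
    refine ⟨i, hi, fun j hj => ?_⟩
    by_contra h
    exact hmin j h hj
  -- The error term involves only larger diagonals and is covered by the induction hypothesis.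
  have h₁ : orbMat m R (cnt x (mid i x y)) * orbMat m R (cnt (mid i x y) y) -
      orbMat m R (cnt x y) ∈ S :=
    mem_of_orbMat_mem (sub_mem (mul_mem (orbMat_mem _) (orbMat_mem _)) (orbMat_mem _)) S
      fun x' y' h => ih (x', y') (exists_gt_of_mid_ne_zero hmin h)
  -- The product passes through the weight of `mid i x y`, which exceeds `lam`, so `v` kills it.
  have h₂ : orbMat m R (cnt x (mid i x y)) * orbMat m R (cnt (mid i x y) y) ∈ S := by
    have hlt := toLex_wt_lt_wt_mid (hx.trans hy.symm) hmin hi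
    rw [hx] at hlt
    have h₃ := hgt _ hlt _ (orbMat_mem (cnt (mid i x y) y))
    rw [wtProj_mul_orbMat, if_pos rfl] at h₃
    rw [hS, mul_assoc, mul_assoc, h₃, mul_zero, mul_zero]
    exact Submodule.zero_mem _
  have := S.sub_mem h₂ h₁
  rwa [sub_sub_cancel] at this

end WordMatrix

/-! ### Symmetric rational matrices and positivity -/

section RationalMatrix

variable {X : Type*} [Fintype X]

/-- The diagonal entries of `cᵀ c` are sums of squares of the entries of the columns of `c`. -/
theorem Matrix.eq_zero_of_transpose_mul_self_rat {c : Matrix X X ℚ} (h : c.transpose * c = 0) :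
    c = 0 := by
  ext i j
  have h₁ := congrFun (congrFun h j) j
  rw [Matrix.mul_apply, Matrix.zero_apply] at h₁
  simp only [Matrix.transpose_apply] at h₁
  rw [Finset.sum_eq_zero_iff_of_nonneg (fun i _ => mul_self_nonneg _)] at h₁
  simpa using h₁ i (Finset.mem_univ i)

variable [DecidableEq X]

/-- One factor `b` is removed at a time: if `b ^ (n + 2) * c = 0`, then `b ^ (n + 1) * c` has zero
product with its transpose. -/
theorem Matrix.mul_eq_zero_of_pow_mul_eq_zero {b c : Matrix X X ℚ} (hb : b.transpose = b) (n : ℕ)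
    (h : b ^ n * c = 0) : b * c = 0 := by
  induction n with
  | zero =>
    rw [pow_zero, one_mul] at h
    rw [h, mul_zero]
  | succ n ih =>
    rcases n with _ | n
    · simpa using h
    · apply ih
      apply Matrix.eq_zero_of_transpose_mul_self_rat
      have e : (b ^ (n + 1) * c).transpose = (b ^ n * c).transpose * b := by
        rw [pow_succ', mul_assoc, Matrix.transpose_mul, hb]
      rw [e, mul_assoc, ← mul_assoc b, ← pow_succ', h, mul_zero]

/-- The projection to the kernel of a symmetric rational matrix is a polynomial in it. -/
theorem Matrix.exists_polynomial_mul_eq_zero {b : Matrix X X ℚ} (hb : b.transpose = b) :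
    ∃ r : Polynomial ℚ, b * (1 + b * Polynomial.aeval b r) = 0 := by
  -- Write the characteristic polynomial as a power of `X` times `g` with nonzero constant term.
  -- Cayley-Hamilton and the previous lemma give `b * g(b) = 0`, and `g(b) / g(0)` has the required
  -- form `1 + b * r(b)`.
  obtain ⟨g, hg, hd⟩ := Polynomial.exists_eq_pow_rootMultiplicity_mul_and_not_dvd b.charpoly
    b.charpoly_monic.ne_zero 0
  rw [Polynomial.C_0, sub_zero] at hg hd
  rw [Polynomial.X_dvd_iff] at hd
  have h₀ : b * Polynomial.aeval b g = 0 := by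
    apply Matrix.mul_eq_zero_of_pow_mul_eq_zero hb (b.charpoly.rootMultiplicity 0)
    have := Matrix.aeval_self_charpoly b
    rw [hg] at this
    simpa using this
  refine ⟨Polynomial.C (g.coeff 0)⁻¹ * g.divX, ?_⟩
  have h₁ : 1 + b * Polynomial.aeval b (Polynomial.C (g.coeff 0)⁻¹ * g.divX) =
      (g.coeff 0)⁻¹ • Polynomial.aeval b g := by
    have : Polynomial.aeval b g =
        b * Polynomial.aeval b g.divX + algebraMap ℚ _ (g.coeff 0) := by
      conv_lhs => rw [← Polynomial.X_mul_divX_add g]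
      rw [map_add, map_mul, Polynomial.aeval_X, Polynomial.aeval_C]
    rw [this, smul_add, Algebra.algebraMap_eq_smul_one, smul_smul, inv_mul_cancel₀ hd, one_smul,
      map_mul, Polynomial.aeval_C, Algebra.algebraMap_eq_smul_one, smul_mul_assoc, one_mul,
      mul_smul_comm, add_comm]
  rw [h₁, mul_smul_comm, h₀, smul_zero]

end RationalMatrix

/-! ### Primitive symmetric idempotents -/

namespace WordMatrix

open Finset

variable {m d : ℕ}

/-- Symmetric idempotents of the algebra of invariant rational matrices. -/
structure IsSymIdem (e : Matrix (Fin m → Fin d) (Fin m → Fin d) ℚ) : Prop where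
  mem : e ∈ invAlg m d ℚ
  symm : e.transpose = e
  idem : e * e = e

/-- A nonzero symmetric idempotent that is not the sum of two others. -/
structure IsPrimSymIdem (e : Matrix (Fin m → Fin d) (Fin m → Fin d) ℚ) : Prop
    extends IsSymIdem e where
  ne_zero : e ≠ 0
  eq_or_eq : ∀ p, IsSymIdem p → e * p = p → p = 0 ∨ p = e

theorem aeval_mem_invAlg {R : Type*} [CommRing R] {b : Matrix (Fin m → Fin d) (Fin m → Fin d) R}
    (hb : b ∈ invAlg m d R) (r : Polynomial R) : Polynomial.aeval b r ∈ invAlg m d R :=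
  Algebra.adjoin_le (Set.singleton_subset_iff.mpr hb) (Polynomial.aeval_mem_adjoin_singleton R b)

theorem transpose_aeval {X R : Type*} [Fintype X] [DecidableEq X] [CommRing R] {b : Matrix X X R}
    (hb : b.transpose = b) (r : Polynomial R) :
    (Polynomial.aeval b r).transpose = Polynomial.aeval b r := by
  induction r using Polynomial.induction_on' with
  | add p q hp hq => rw [map_add, Matrix.transpose_add, hp, hq]
  | monomial n a =>
    rw [Polynomial.aeval_monomial, Matrix.transpose_mul, Matrix.transpose_pow, hb,
      Algebra.algebraMap_eq_smul_one, Matrix.transpose_smul, Matrix.transpose_one]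
    simp

theorem commute_aeval {R S : Type*} [CommRing R] [Ring S] [Algebra R S] {c b : S}
    (h : Commute c b) (r : Polynomial R) : Commute c (Polynomial.aeval b r) := by
  rw [Polynomial.aeval_eq_sum_range]
  exact Commute.sum_right _ _ _ fun i _ => (h.pow_right i).smul_right _

/-- Nonzero elements `a` of the left ideal generated by a primitive idempotent have left
inverses. -/
theorem IsPrimSymIdem.exists_mul_eq {e a : Matrix (Fin m → Fin d) (Fin m → Fin d) ℚ}
    (he : IsPrimSymIdem e) (ha : a ∈ invAlg m d ℚ) (hae : a * e = a) (h0 : a ≠ 0) :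
    ∃ s ∈ invAlg m d ℚ, (s * a.transpose) * a = e := by
  have hea : e * a.transpose = a.transpose := by
    rw [← he.symm, ← Matrix.transpose_mul, hae]
  obtain ⟨b, hb⟩ : ∃ b, b = a.transpose * a := ⟨_, rfl⟩
  have hbs : b.transpose = b := by rw [hb, Matrix.transpose_mul, Matrix.transpose_transpose]
  have heb : e * b = b := by rw [hb, ← mul_assoc, hea]
  have hbe : b * e = b := by rw [hb, mul_assoc, hae]
  have hbm : b ∈ invAlg m d ℚ := hb ▸ mul_mem (transpose_mem_invAlg ha) ha
  obtain ⟨r, hr⟩ := Matrix.exists_polynomial_mul_eq_zero hbs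
  obtain ⟨s, hs⟩ : ∃ s, s = Polynomial.aeval b r := ⟨_, rfl⟩
  rw [← hs] at hr
  have hsm : s ∈ invAlg m d ℚ := hs ▸ aeval_mem_invAlg hbm r
  have hss : s.transpose = s := hs ▸ transpose_aeval hbs r
  have hcb : b * s = s * b := hs ▸ commute_aeval (Commute.refl b) r
  have hce : e * s = s * e := hs ▸ commute_aeval (heb.trans hbe.symm : Commute e b) r
  -- This is the projection to the kernel of `b`. It commutes with `e`, so `p * e` is a symmetric
  -- idempotent below `e`, and primitivity leaves two cases: `0`, which inverts `b` on `e`, or `e`,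
  -- which forces `b = 0` and hence `a = 0` by positivity.
  obtain ⟨p, hp⟩ : ∃ p, p = 1 + b * s := ⟨_, rfl⟩
  rw [← hp] at hr
  have hpm : p ∈ invAlg m d ℚ := hp ▸ add_mem (one_mem _) (mul_mem hbm hsm)
  have hps : p.transpose = p := by
    rw [hp, Matrix.transpose_add, Matrix.transpose_mul, Matrix.transpose_one, hbs, hss, hcb]
  have hpb : p * b = 0 := by
    have := congrArg Matrix.transpose hr
    rwa [Matrix.transpose_mul, hps, hbs, Matrix.transpose_zero] at this
  have hpp : p * p = p := by
    conv_lhs => rhs; rw [hp]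
    rw [mul_add, mul_one, ← mul_assoc, hpb, zero_mul, add_zero]
  have hpe : e * p = p * e := by
    rw [hp, mul_add, add_mul, mul_one, one_mul, ← mul_assoc, heb, mul_assoc, ← hce, ← mul_assoc,
      hbe]
  have hq : IsSymIdem (p * e) := by
    refine ⟨mul_mem hpm he.mem, ?_, ?_⟩
    · rw [Matrix.transpose_mul, hps, he.symm, hpe]
    · rw [mul_assoc, ← mul_assoc e, hpe, mul_assoc p, he.idem, ← mul_assoc, hpp]
  rcases he.eq_or_eq (p * e) hq (by rw [← mul_assoc, hpe, mul_assoc, he.idem]) with h | h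
  · refine ⟨-s, neg_mem hsm, ?_⟩
    rw [mul_assoc, ← hb, neg_mul, ← hcb]
    have : e + b * s = 0 := by
      rw [← h, hp, add_mul, one_mul, mul_assoc, ← hce, ← mul_assoc, hbe]
    exact (eq_neg_of_add_eq_zero_left this).symm
  · exfalso
    apply h0
    apply Matrix.eq_zero_of_transpose_mul_self_rat
    rw [← hb, ← hbe, ← h, ← mul_assoc, hr, zero_mul]

/-- Primitive symmetric idempotents are absolutely primitive. -/
theorem IsPrimSymIdem.mul_mul_mem_span {e a : Matrix (Fin m → Fin d) (Fin m → Fin d) ℚ}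
    (he : IsPrimSymIdem e) (ha : a ∈ invAlg m d ℚ) : e * a * e ∈ Submodule.span ℚ {e} := by
  classical
  -- The weights that occur in the left ideal generated by `e`. A maximal one plays the role of a
  -- highest weight.
  let L := (univ.image (wt : (Fin m → Fin d) → Fin d → ℕ)).filter fun lam =>
    ∃ s ∈ invAlg m d ℚ, wtProj m ℚ lam * s * e ≠ 0
  have hL : L.Nonempty := by
    by_contra hL
    rw [not_nonempty_iff_eq_empty, filter_eq_empty_iff] at hL
    apply he.ne_zero
    rw [← one_mul e, ← sum_wtProj (m := m) (d := d) (R := ℚ), sum_mul]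
    refine sum_eq_zero fun lam hlam => ?_
    have := hL hlam
    push Not at this
    simpa using this 1 (one_mem _)
  obtain ⟨lam, hlam, hmax⟩ := exists_max_image L toLex hL
  obtain ⟨-, s, hs, h0⟩ := mem_filter.mp hlam
  have hidem : wtProj m ℚ lam * wtProj m ℚ lam = wtProj m ℚ lam := by
    rw [wtProj, Matrix.diagonal_mul_diagonal]
    simp
  obtain ⟨t, ht, hte⟩ := he.exists_mul_eq (a := wtProj m ℚ lam * s * e)
    (mul_mem (mul_mem (wtProj_mem _) hs) he.mem) (by rw [mul_assoc, he.idem]) h0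
  set v := wtProj m ℚ lam * s * e with hv
  set u := t * v.transpose with hu
  have hvm : v ∈ invAlg m d ℚ := mul_mem (mul_mem (wtProj_mem _) hs) he.mem
  have hum : u ∈ invAlg m d ℚ := mul_mem ht (transpose_mem_invAlg hvm)
  have hpv : wtProj m ℚ lam * v = v := by
    rw [hv, ← mul_assoc, ← mul_assoc, hidem]
  have hup : u * wtProj m ℚ lam = u := by
    have : v.transpose * wtProj m ℚ lam = v.transpose := by
      have h := congrArg Matrix.transpose hpv
      rwa [Matrix.transpose_mul, wtProj, Matrix.diagonal_transpose, ← wtProj] at h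
    rw [hu, mul_assoc, this]
  -- With `u * v = e` one has `e * a * e = u * (v * a * u) * v`. Maximality of `lam` supplies the
  -- vanishing in larger weights.
  have key := WordMatrix.mul_mul_mem_span hup hpv (fun mu hmu s' hs' => by
    by_contra hne
    have hmem : mu ∈ L := by
      refine mem_filter.mpr ⟨?_, s' * wtProj m ℚ lam * s,
        mul_mem (mul_mem hs' (wtProj_mem _)) hs, ?_⟩
      · by_contra himg
        have : wtProj m ℚ mu = 0 := by
          ext x y
          rw [wtProj, Matrix.diagonal_apply]
          have : wt x ≠ mu := fun h => himg (mem_image.mpr ⟨x, mem_univ _, h⟩)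
          simp [this]
        rw [this, zero_mul, zero_mul] at hne
        exact hne rfl
      · rw [hv] at hne
        simpa only [mul_assoc] using hne
    exact absurd (hmax mu hmem) (not_le.mpr hmu)) (mul_mem (mul_mem hvm ha) hum)
  rw [hte] at key
  have e₁ : u * (v * a * u) * v = e * a * e := by
    rw [← hte]
    simp only [mul_assoc]
  rwa [e₁] at key

theorem IsSymIdem.sub {e p : Matrix (Fin m → Fin d) (Fin m → Fin d) ℚ} (he : IsSymIdem e)
    (hp : IsSymIdem p) (h : e * p = p) : IsSymIdem (e - p) := by
  have h' : p * e = p := by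
    rw [← hp.symm, ← he.symm, ← Matrix.transpose_mul, h]
  refine ⟨sub_mem he.mem hp.mem, ?_, ?_⟩
  · rw [Matrix.transpose_sub, he.symm, hp.symm]
  · rw [sub_mul, mul_sub, mul_sub, he.idem, hp.idem, h, h', sub_self, sub_zero]

/-- Every symmetric idempotent is a sum of orthogonal primitive ones. -/
theorem IsSymIdem.exists_decomposition {e : Matrix (Fin m → Fin d) (Fin m → Fin d) ℚ}
    (he : IsSymIdem e) : ∃ (ι : Type) (_ : Fintype ι)
      (f : ι → Matrix (Fin m → Fin d) (Fin m → Fin d) ℚ), (∀ i, IsPrimSymIdem (f i)) ∧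
        (∀ i j, i ≠ j → f i * f j = 0) ∧ ∑ i, f i = e := by
  classical
  let rg : Matrix (Fin m → Fin d) (Fin m → Fin d) ℚ →
      Submodule ℚ (Matrix (Fin m → Fin d) (Fin m → Fin d) ℚ) :=
    fun e => LinearMap.range (LinearMap.mulLeft ℚ e)
  -- Induction on the right ideal generated by `e` in the full matrix algebra; it shrinks strictly
  -- when `e` splits as `p + (e - p)`.
  generalize hN : rg e = N
  induction N using (wellFounded_lt (α := Submodule ℚ
    (Matrix (Fin m → Fin d) (Fin m → Fin d) ℚ))).induction generalizing e with
  | _ N ih =>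
  subst hN
  by_cases h0 : e = 0
  · exact ⟨Empty, inferInstance, Empty.elim, fun i => i.elim, fun i => i.elim, by simp [h0]⟩
  by_cases hprim : ∀ p, IsSymIdem p → e * p = p → p = 0 ∨ p = e
  · refine ⟨Unit, inferInstance, fun _ => e, fun _ => ⟨he, h0, hprim⟩, fun i j h => ?_, by simp⟩
    exact absurd (Subsingleton.elim i j) h
  · push Not at hprim
    obtain ⟨p, hp, hep, hp0, hpe⟩ := hprim
    have hpe' : p * e = p := by
      rw [← hp.symm, ← he.symm, ← Matrix.transpose_mul, hep]
    have hlt : ∀ q, IsSymIdem q → e * q = q → q * e = q → q ≠ e → rg q < rg e := by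
      intro q hq h₁ h₂ h₃
      refine lt_of_le_of_ne ?_ fun h => h₃ ?_
      · rintro _ ⟨a, rfl⟩
        exact ⟨q * a, by simp [← mul_assoc, h₁]⟩
      · have : e ∈ rg q := by
          rw [h]
          exact ⟨e, he.idem⟩
        obtain ⟨a, ha⟩ := this
        have ha : q * a = e := ha
        rw [← h₂, ← ha, ← mul_assoc, hq.idem]
    have hs := he.sub hp hep
    obtain ⟨ι₁, _, f₁, hf₁, ho₁, hs₁⟩ := ih _ (hlt p hp hep hpe' hpe) hp rfl
    obtain ⟨ι₂, _, f₂, hf₂, ho₂, hs₂⟩ := ih _ (hlt (e - p) hs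
      (by rw [mul_sub, he.idem, hep]) (by rw [sub_mul, he.idem, hpe'])
      (fun h => hp0 (by simpa using h))) hs rfl
    have a₁ : ∀ i, f₁ i * p = f₁ i := fun i => by
      rw [← hs₁, mul_sum, sum_eq_single i (fun j _ hj => ho₁ i j hj.symm) (by simp),
        (hf₁ i).idem]
    have a₁' : ∀ i, p * f₁ i = f₁ i := fun i => by
      rw [← hs₁, sum_mul, sum_eq_single i (fun j _ hj => ho₁ j i hj) (by simp), (hf₁ i).idem]
    have a₂ : ∀ i, (e - p) * f₂ i = f₂ i := fun i => by
      rw [← hs₂, sum_mul, sum_eq_single i (fun j _ hj => ho₂ j i hj) (by simp), (hf₂ i).idem]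
    have a₂' : ∀ i, f₂ i * (e - p) = f₂ i := fun i => by
      rw [← hs₂, mul_sum, sum_eq_single i (fun j _ hj => ho₂ i j hj.symm) (by simp),
        (hf₂ i).idem]
    refine ⟨ι₁ ⊕ ι₂, inferInstance, Sum.elim f₁ f₂, ?_, ?_, ?_⟩
    · rintro (i | i)
      · exact hf₁ i
      · exact hf₂ i
    · rintro (i | i) (j | j) h
      · exact ho₁ i j fun h' => h (by rw [h'])
      · change f₁ i * f₂ j = 0
        rw [← a₁ i, ← a₂ j, mul_assoc, ← mul_assoc p, mul_sub, hpe', hp.idem, sub_self, zero_mul,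
          mul_zero]
      · change f₂ i * f₁ j = 0
        rw [← a₁' j, ← a₂' i, mul_assoc, ← mul_assoc _ p, sub_mul, hep, hp.idem, sub_self, zero_mul,
          mul_zero]
      · exact ho₂ i j fun h' => h (by rw [h'])
    · rw [Fintype.sum_sum_type]
      simp only [Sum.elim_inl, Sum.elim_inr]
      rw [hs₁, hs₂, add_sub_cancel]

end WordMatrix

/-! ### The trace of the transposition, computed in two ways -/

namespace WordMatrix

open Finset

variable {m d : ℕ}

/-- The map `a ↦ p aᵀ q` on the algebra of invariant matrices. -/
def twist (p q : Matrix (Fin m → Fin d) (Fin m → Fin d) ℚ) (hp : p ∈ invAlg m d ℚ)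
    (hq : q ∈ invAlg m d ℚ) : invAlg m d ℚ →ₗ[ℚ] invAlg m d ℚ where
  toFun a := ⟨p * a.1.transpose * q, mul_mem (mul_mem hp (transpose_mem_invAlg a.2)) hq⟩
  map_add' a b := Subtype.ext (by
    simp [Matrix.transpose_add, mul_add, add_mul])
  map_smul' r a := Subtype.ext (by
    simp [Matrix.transpose_smul])

theorem coe_twist (p q : Matrix (Fin m → Fin d) (Fin m → Fin d) ℚ) (hp : p ∈ invAlg m d ℚ)
    (hq : q ∈ invAlg m d ℚ) (a : invAlg m d ℚ) :
    (twist p q hp hq a : Matrix (Fin m → Fin d) (Fin m → Fin d) ℚ) =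
      p * a.1.transpose * q := rfl

/-- The square of the map sends `a` to `p q a p q = 0`, and nilpotent maps have trace zero. -/
theorem trace_twist_of_orthogonal {p q : Matrix (Fin m → Fin d) (Fin m → Fin d) ℚ}
    (hp : IsSymIdem p) (hq : IsSymIdem q) (hpq : p * q = 0) :
    LinearMap.trace ℚ _ (twist p q hp.mem hq.mem) = 0 := by
  have h : IsNilpotent (twist p q hp.mem hq.mem) := by
    refine ⟨2, LinearMap.ext fun a => Subtype.ext ?_⟩
    rw [pow_two, Module.End.mul_apply, coe_twist, coe_twist, Matrix.transpose_mul,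
      Matrix.transpose_mul, Matrix.transpose_transpose, hp.symm, hq.symm, ← mul_assoc, ← mul_assoc,
      hpq, zero_mul, zero_mul, zero_mul]
    rfl
  exact (LinearMap.isNilpotent_trace_of_isNilpotent h).eq_zero

/-- By absolute primitivity the map has its image in the line spanned by `p`, and it fixes `p`
because `p` is a symmetric idempotent. -/
theorem trace_twist_self {p : Matrix (Fin m → Fin d) (Fin m → Fin d) ℚ} (hp : IsPrimSymIdem p) :
    LinearMap.trace ℚ _ (twist p p hp.mem hp.mem) = 1 := by
  let P : invAlg m d ℚ := ⟨p, hp.mem⟩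
  have hne : P ≠ 0 := fun h => hp.ne_zero (congrArg Subtype.val h)
  have hP : twist p p hp.mem hp.mem P = P := Subtype.ext (by
    rw [coe_twist]
    simp only [P]
    rw [hp.symm, hp.idem, hp.idem])
  have hex : ∀ a, ∃ c : ℚ, twist p p hp.mem hp.mem a = c • P := fun a => by
    obtain ⟨c, hc⟩ := Submodule.mem_span_singleton.mp
      (hp.mul_mul_mem_span (transpose_mem_invAlg a.2))
    exact ⟨c, Subtype.ext hc.symm⟩
  choose c hc using hex
  have hinj : ∀ r s : ℚ, r • P = s • P → r = s := fun r s h => smul_left_injective ℚ hne h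
  let φ : invAlg m d ℚ →ₗ[ℚ] ℚ :=
    { toFun := c
      map_add' := fun a b => hinj _ _ (by rw [add_smul, ← hc, ← hc, ← hc, map_add])
      map_smul' := fun r a => hinj _ _ (by
        rw [RingHom.id_apply, smul_eq_mul, mul_smul, ← hc, ← hc, map_smul]) }
  have h : twist p p hp.mem hp.mem = φ.smulRight P := LinearMap.ext hc
  rw [h, LinearMap.trace_smulRight]
  exact hinj _ _ ((hc P).symm.trans (hP.trans (one_smul _ _).symm))

variable (m d) in
/-- The matrices of natural numbers that count the pairs of letters of two words. -/
def cntSet : Finset (Fin d → Fin d → ℕ) :=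
  univ.image fun p : (Fin m → Fin d) × (Fin m → Fin d) => cnt p.1 p.2

theorem cnt_mem_cntSet (x y : Fin m → Fin d) : cnt x y ∈ cntSet m d :=
  mem_image.mpr ⟨(x, y), mem_univ _, rfl⟩

theorem swap_mem_cntSet {A : Fin d → Fin d → ℕ} (hA : A ∈ cntSet m d) :
    (fun i j => A j i) ∈ cntSet m d := by
  obtain ⟨⟨x, y⟩, -, rfl⟩ := mem_image.mp hA
  refine mem_image.mpr ⟨(y, x), mem_univ _, ?_⟩
  funext i j
  exact cnt_comm _ _ _ _

/-- The invariant matrix with given values on the orbits. -/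
def ofOrbitFun : (cntSet m d → ℚ) →ₗ[ℚ] invAlg m d ℚ where
  toFun φ := ⟨Matrix.of fun x y => φ ⟨cnt x y, cnt_mem_cntSet x y⟩, fun σ x y => by
    simp only [Matrix.of_apply, cnt_comp_perm]⟩
  map_add' _ _ := rfl
  map_smul' _ _ := rfl

theorem ofOrbitFun_bijective : Function.Bijective (ofOrbitFun (m := m) (d := d)) := by
  constructor
  · intro φ ψ h
    funext ⟨A, hA⟩
    obtain ⟨⟨x, y⟩, -, rfl⟩ := mem_image.mp hA
    exact congrFun (congrFun (congrArg Subtype.val h) x) y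
  · intro a
    obtain ⟨f, hf, -⟩ := eq_sum_orbMat a.2
    refine ⟨fun A => f A.1, Subtype.ext ?_⟩
    ext x y
    exact hf x y

/-- Invariant matrices are functions on the set of orbits. -/
noncomputable def invAlgEquiv : (cntSet m d → ℚ) ≃ₗ[ℚ] invAlg m d ℚ :=
  LinearEquiv.ofBijective ofOrbitFun ofOrbitFun_bijective

theorem invAlgEquiv_apply (φ : cntSet m d → ℚ) (x y : Fin m → Fin d) :
    (invAlgEquiv φ).1 x y = φ ⟨cnt x y, cnt_mem_cntSet x y⟩ := rfl

theorem trace_comp_perm {α : Type*} [Fintype α] [DecidableEq α] (τ : α → α) :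
    LinearMap.trace ℚ (α → ℚ) (LinearMap.funLeft ℚ ℚ τ) = #{a | τ a = a} := by
  rw [LinearMap.trace_eq_matrix_trace ℚ (Pi.basisFun ℚ α), Matrix.trace]
  simp only [Matrix.diag_apply, LinearMap.toMatrix_apply, Pi.basisFun_apply, Pi.basisFun_repr,
    LinearMap.funLeft_apply, Pi.single_apply]
  rw [sum_boole]

/-- In orbit coordinates transposition is the permutation of the index set that transposes count
matrices, and the trace of a permutation is its number of fixed points. -/
theorem trace_twist_one :
    LinearMap.trace ℚ _ (twist (m := m) (d := d) 1 1 (one_mem _) (one_mem _)) =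
      #{A ∈ cntSet m d | ∀ i j, A j i = A i j} := by
  let τ : cntSet m d → cntSet m d := fun A => ⟨fun i j => A.1 j i, swap_mem_cntSet A.2⟩
  have h : twist (m := m) (d := d) 1 1 (one_mem _) (one_mem _) =
      invAlgEquiv.conj (LinearMap.funLeft ℚ ℚ τ) := by
    ext a
    obtain ⟨φ, rfl⟩ := invAlgEquiv.surjective a
    rw [LinearEquiv.conj_apply_apply, LinearEquiv.symm_apply_apply]
    rename_i x y
    rw [coe_twist, one_mul, mul_one, Matrix.transpose_apply, invAlgEquiv_apply, invAlgEquiv_apply,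
      LinearMap.funLeft_apply]
    congr 1
    apply Subtype.ext
    funext i j
    exact cnt_comm _ _ _ _
  rw [h, LinearMap.trace_conj', trace_comp_perm]
  congr 1
  refine card_bij (fun A _ => A.1) ?_ ?_ ?_
  · intro A hA
    rw [mem_filter] at hA ⊢
    exact ⟨A.2, fun i j => congrFun (congrFun (congrArg Subtype.val hA.2) i) j⟩
  · intro A _ B _ h
    exact Subtype.ext h
  · intro A hA
    rw [mem_filter] at hA
    refine ⟨⟨A, hA.1⟩, mem_filter.mpr ⟨mem_univ _, Subtype.ext ?_⟩, rfl⟩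
    funext i j
    exact hA.2 i j

/-- The identity matrix is a sum of orthogonal absolutely primitive idempotents, and their number is
the number of symmetric matrices that count the pairs of letters of two words. -/
theorem exists_decomposition_one (m d : ℕ) : ∃ (ι : Type) (_ : Fintype ι)
    (f : ι → Matrix (Fin m → Fin d) (Fin m → Fin d) ℚ), (∀ i, IsPrimSymIdem (f i)) ∧
      (∀ i j, i ≠ j → f i * f j = 0) ∧ ∑ i, f i = 1 ∧
        Fintype.card ι = #{A ∈ cntSet m d | ∀ i j, A j i = A i j} := by
  classical
  have h1 : IsSymIdem (1 : Matrix (Fin m → Fin d) (Fin m → Fin d) ℚ) :=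
    ⟨one_mem _, Matrix.transpose_one, mul_one 1⟩
  obtain ⟨ι, _, f, hf, ho, hs⟩ := h1.exists_decomposition
  refine ⟨ι, inferInstance, f, hf, ho, hs, ?_⟩
  -- Inserting `1 = ∑ i, f i` on both sides splits the transposition; only the diagonal terms
  -- contribute to the trace, each with `1`.
  have hT : twist (m := m) (d := d) 1 1 (one_mem _) (one_mem _) =
      ∑ i, ∑ j, twist (f i) (f j) (hf i).mem (hf j).mem := by
    refine LinearMap.ext fun a => Subtype.ext ?_
    simp only [LinearMap.sum_apply, AddSubmonoidClass.coe_finsetSum, coe_twist]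
    simp only [← mul_sum, ← sum_mul, hs]
  have ht := trace_twist_one (m := m) (d := d)
  rw [hT, map_sum] at ht
  have : ∀ i, LinearMap.trace ℚ _ (∑ j, twist (f i) (f j) (hf i).mem (hf j).mem) = 1 := by
    intro i
    rw [map_sum, sum_eq_single i, trace_twist_self (hf i)]
    · intro j _ hj
      exact trace_twist_of_orthogonal (hf i).toIsSymIdem (hf j).toIsSymIdem (ho i j hj.symm)
    · simp
  rw [sum_congr rfl fun i _ => this i, sum_const, nsmul_eq_mul, mul_one] at ht
  exact_mod_cast ht

end WordMatrix

/-! ### Length of a module from a decomposition of the identity -/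

section Length

variable {R M : Type*} [Ring R] [AddCommGroup M] [Module R M]

/-- If all compressions of endomorphisms to the range of an idempotent `e` are scalars, this range
is simple. -/
theorem isSimpleModule_range_of_compression_scalar [IsSemisimpleModule R M] {k : Type*} [Field k]
    [Module k M] [SMul k R] [IsScalarTower k R M] {e : Module.End R M} (he : e * e = e)
    (hne : e ≠ 0) (h : ∀ g : Module.End R M, ∃ c : k, ∀ v, e (g (e v)) = c • e v) :
    IsSimpleModule R (LinearMap.range e) := by
  have hfix : ∀ v ∈ LinearMap.range e, e v = v := by
    rintro _ ⟨v, rfl⟩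
    exact LinearMap.congr_fun he v
  have key : ∀ N ≤ LinearMap.range e, N = ⊥ ∨ N = LinearMap.range e := by
    intro N hN
    obtain ⟨Q, hQ⟩ := exists_isCompl N
    -- The hypothesis is applied to a projection to `N`. Its compression is the scalar `c`: if `c =
    -- 0` then `N` is zero, and otherwise the whole range of `e` lies in `N`.
    obtain ⟨c, hc⟩ := h (N.subtype ∘ₗ N.projectionOnto Q hQ)
    have hmem : ∀ v, (N.subtype ∘ₗ N.projectionOnto Q hQ) v ∈ N := fun v =>
      (N.projectionOnto Q hQ v).2
    rcases eq_or_ne c 0 with rfl | hc0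
    · left
      rw [eq_bot_iff]
      intro v hv
      have h₁ := hc v
      rw [hfix v (hN hv), zero_smul, hfix _ (hN (hmem v))] at h₁
      have h₂ : (N.subtype ∘ₗ N.projectionOnto Q hQ) v = v :=
        congrArg Subtype.val (Submodule.projectionOnto_apply_left hQ ⟨v, hv⟩)
      rw [Submodule.mem_bot, ← h₂, h₁]
    · right
      refine le_antisymm hN ?_
      rintro _ ⟨v, rfl⟩
      have h₁ := hc v
      rw [hfix _ (hN (hmem _))] at h₁
      rw [← inv_smul_smul₀ hc0 (e v), ← h₁]
      exact N.smul_of_tower_mem _ (hmem _)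
  have : Nontrivial (LinearMap.range e) := by
    rw [Submodule.nontrivial_iff_ne_bot]
    exact fun h => hne (LinearMap.range_eq_bot.mp h)
  rw [isSimpleModule_iff]
  refine ⟨fun N => ?_⟩
  have hinj := Submodule.map_injective_of_injective (LinearMap.range e).injective_subtype
  rcases key (N.map (LinearMap.range e).subtype) (Submodule.map_subtype_le _ _) with h | h
  · exact Or.inl (hinj (by rw [h, Submodule.map_bot]))
  · exact Or.inr (hinj (by rw [h, Submodule.map_subtype_top]))

/-- Orthogonal idempotents with sum `1` make `M` the direct product of their ranges, each of length
one. -/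
theorem length_eq_card_of_idempotents {ι : Type*} [Fintype ι] {e : ι → Module.End R M}
    (hidem : ∀ i, e i * e i = e i) (ho : ∀ i j, i ≠ j → e i * e j = 0) (hs : ∑ i, e i = 1)
    (hsimple : ∀ i, IsSimpleModule R (LinearMap.range (e i))) :
    Module.length R M = Fintype.card ι := by
  have hfix : ∀ i, ∀ v ∈ LinearMap.range (e i), e i v = v := by
    rintro i _ ⟨v, rfl⟩
    exact LinearMap.congr_fun (hidem i) v
  have hzero : ∀ i j, i ≠ j → ∀ v ∈ LinearMap.range (e j), e i v = 0 := by
    rintro i j hij _ ⟨v, rfl⟩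
    exact LinearMap.congr_fun (ho i j hij) v
  let E : M ≃ₗ[R] ∀ i, LinearMap.range (e i) := LinearEquiv.ofLinearMap
    (LinearMap.pi fun i => (e i).rangeRestrict)
    (∑ i, (LinearMap.range (e i)).subtype ∘ₗ LinearMap.proj i)
    (by
      refine LinearMap.ext fun v => funext fun i => Subtype.ext ?_
      change e i ((∑ j, (LinearMap.range (e j)).subtype ∘ₗ LinearMap.proj j) v) = v i
      rw [LinearMap.sum_apply, map_sum, Finset.sum_eq_single i]
      · exact hfix i _ (v i).2
      · exact fun j _ hj => hzero i j hj.symm _ (v j).2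
      · simp)
    (by
      refine LinearMap.ext fun v => ?_
      rw [LinearMap.comp_apply, LinearMap.sum_apply]
      change ∑ i, e i v = v
      rw [← LinearMap.sum_apply, hs]
      rfl)
  rw [E.length_eq, Module.length_pi_of_fintype]
  simp [Module.length_eq_one]

end Length

/-! ### Length of the tensor powers over a field of characteristic zero -/

namespace WordMatrix

open Finset

variable {m d : ℕ} {k : Type*} [Field k]

theorem map_orbMat [CharZero k] (A : Fin d → Fin d → ℕ) :
    (algebraMap ℚ k).mapMatrix (orbMat m ℚ A) = orbMat m k A := by
  ext x y
  rw [RingHom.mapMatrix_apply, Matrix.map_apply, orbMat_apply, orbMat_apply]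
  split_ifs <;> simp

theorem map_mem_invAlg [CharZero k] {a : Matrix (Fin m → Fin d) (Fin m → Fin d) ℚ}
    (ha : a ∈ invAlg m d ℚ) : (algebraMap ℚ k).mapMatrix a ∈ invAlg m d k := fun σ x y =>
  congrArg (algebraMap ℚ k) (ha σ x y)

/-- The compressions to an absolutely primitive idempotent are scalars over all fields of
characteristic zero. -/
theorem IsPrimSymIdem.map_mul_mul_mem_span [CharZero k]
    {e : Matrix (Fin m → Fin d) (Fin m → Fin d) ℚ} (he : IsPrimSymIdem e)
    {a : Matrix (Fin m → Fin d) (Fin m → Fin d) k} (ha : a ∈ invAlg m d k) :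
    (algebraMap ℚ k).mapMatrix e * a * (algebraMap ℚ k).mapMatrix e ∈
      Submodule.span k {(algebraMap ℚ k).mapMatrix e} := by
  refine mem_of_orbMat_mem ha ((Submodule.span k {(algebraMap ℚ k).mapMatrix e}).comap
      (LinearMap.mulRight k ((algebraMap ℚ k).mapMatrix e) ∘ₗ
        LinearMap.mulLeft k ((algebraMap ℚ k).mapMatrix e))) fun x y _ => ?_
  change (algebraMap ℚ k).mapMatrix e * orbMat m k (cnt x y) * (algebraMap ℚ k).mapMatrix e ∈
    Submodule.span k {(algebraMap ℚ k).mapMatrix e}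
  rw [← map_orbMat, ← map_mul, ← map_mul]
  obtain ⟨c, hc⟩ := Submodule.mem_span_singleton.mp (he.mul_mul_mem_span (orbMat_mem (cnt x y)))
  rw [← hc]
  refine Submodule.mem_span_singleton.mpr ⟨algebraMap ℚ k c, ?_⟩
  ext i j
  simp

section Representation

variable {V : Type*} [AddCommGroup V] [Module k V] {ρ : Representation k (Equiv.Perm (Fin m)) V}
  {b : Module.Basis (Fin m → Fin d) k V}

theorem repr_rho (hb : ∀ σ x, ρ σ (b x) = b (x ∘ σ.symm)) (σ : Equiv.Perm (Fin m)) (v : V)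
    (x : Fin m → Fin d) : b.repr (ρ σ v) x = b.repr v (x ∘ σ) := by
  have h : Finsupp.lapply x ∘ₗ b.repr.toLinearMap ∘ₗ ρ σ =
      Finsupp.lapply (x ∘ σ) ∘ₗ b.repr.toLinearMap := by
    apply b.ext
    intro y
    change b.repr (ρ σ (b y)) x = b.repr (b y) (x ∘ σ)
    rw [hb, b.repr_self, b.repr_self, Finsupp.single_apply, Finsupp.single_apply]
    have : y ∘ σ.symm = x ↔ y = x ∘ σ := by
      constructor
      · rintro rfl
        funext i
        simp
      · rintro rfl
        funext i
        simp
    simp only [this]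
  exact LinearMap.congr_fun h v

theorem toMatrix_mem_invAlg (hb : ∀ σ x, ρ σ (b x) = b (x ∘ σ.symm)) {f : V →ₗ[k] V}
    (hf : ∀ σ, f ∘ₗ ρ σ = ρ σ ∘ₗ f) : LinearMap.toMatrix b b f ∈ invAlg m d k := fun σ x y => by
  rw [LinearMap.toMatrix_apply, LinearMap.toMatrix_apply, ← repr_rho hb,
    ← LinearMap.comp_apply (ρ σ) f, ← hf, LinearMap.comp_apply, hb]
  congr 4
  funext i
  simp

theorem toLin_comp_rho (hb : ∀ σ x, ρ σ (b x) = b (x ∘ σ.symm))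
    {a : Matrix (Fin m → Fin d) (Fin m → Fin d) k} (ha : a ∈ invAlg m d k)
    (σ : Equiv.Perm (Fin m)) : Matrix.toLin b b a ∘ₗ ρ σ = ρ σ ∘ₗ Matrix.toLin b b a := by
  apply b.ext
  intro y
  apply b.repr.injective
  ext x
  have h : ∀ x y, b.repr (Matrix.toLin b b a (b y)) x = a x y := fun x y => by
    rw [← LinearMap.toMatrix_apply, LinearMap.toMatrix_toLin]
  rw [LinearMap.comp_apply, LinearMap.comp_apply, repr_rho hb, hb, h, h, ← ha σ]
  congr 1
  funext i
  simp

/-- The length of a permutation representation on words is the number of the symmetric matrices that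
count the pairs of letters of two words. -/
theorem height_top_eq_card [CharZero k] (hb : ∀ σ x, ρ σ (b x) = b (x ∘ σ.symm)) :
    Order.height (⊤ : Subrepresentation ρ) = #{A ∈ cntSet m d | ∀ i j, A j i = A i j} := by
  obtain ⟨ι, _, f, hf, ho, hs, hcard⟩ := exists_decomposition_one m d
  rw [← hcard, ← Order.height_orderIso Subrepresentation.subrepresentationSubmoduleOrderIso,
    map_top, ← Module.length_eq_height]
  let F : ι → Matrix (Fin m → Fin d) (Fin m → Fin d) k := fun i => (algebraMap ℚ k).mapMatrix (f i)
  have hF : ∀ i, F i ∈ invAlg m d k := fun i => map_mem_invAlg (hf i).mem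
  let I : ι → Representation.IntertwiningMap ρ ρ := fun i =>
    ⟨Matrix.toLin b b (F i), toLin_comp_rho hb (hF i)⟩
  let e : ι → Module.End (MonoidAlgebra k (Equiv.Perm (Fin m))) ρ.asModule := fun i =>
    Representation.IntertwiningMap.equivAlgEnd ρ (I i)
  have hidem : ∀ i, e i * e i = e i := fun i => by
    simp only [e]
    rw [← map_mul]
    congr 1
    apply Representation.IntertwiningMap.ext
    change Matrix.toLin b b (F i) ∘ₗ Matrix.toLin b b (F i) = Matrix.toLin b b (F i)
    rw [← Matrix.toLin_mul, ← map_mul, (hf i).idem]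
  have horth : ∀ i j, i ≠ j → e i * e j = 0 := fun i j hij => by
    simp only [e]
    rw [← map_mul, ← map_zero (Representation.IntertwiningMap.equivAlgEnd ρ)]
    congr 1
    apply Representation.IntertwiningMap.ext
    change Matrix.toLin b b (F i) ∘ₗ Matrix.toLin b b (F j) = 0
    rw [← Matrix.toLin_mul, ← map_mul, ho i j hij, map_zero, map_zero]
  have hsum : ∑ i, e i = 1 := by
    have h : ∀ v : V, ∑ i, Matrix.toLin b b (F i) v = v := fun v => by
      rw [← LinearMap.sum_apply, ← map_sum, ← map_sum, hs, map_one, Matrix.toLin_one]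
      rfl
    apply LinearMap.ext
    intro v
    rw [LinearMap.sum_apply]
    exact h v
  have hne : ∀ i, e i ≠ 0 := fun i h => by
    have h₁ : Matrix.toLin b b (F i) = 0 := LinearMap.ext fun v => LinearMap.congr_fun h v
    rw [LinearEquiv.map_eq_zero_iff] at h₁
    apply (hf i).ne_zero
    ext x y
    have h₂ := congrFun (congrFun h₁ x) y
    exact (map_eq_zero (algebraMap ℚ k)).mp h₂
  -- The order of the symmetric group is invertible in `k`, so Maschke's theorem provides the
  -- semisimplicity needed below.
  have : NeZero (Nat.card (Equiv.Perm (Fin m)) : k) :=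
    ⟨Nat.cast_ne_zero.mpr Nat.card_pos.ne'⟩
  refine length_eq_card_of_idempotents hidem horth hsum fun i =>
    isSimpleModule_range_of_compression_scalar (k := k) (hidem i) (hne i) fun g => ?_
  let g' := (Representation.IntertwiningMap.equivAlgEnd ρ).symm g
  -- An endomorphism of the representation has an invariant matrix, so its compression by the
  -- idempotent is a scalar.
  obtain ⟨c, hc⟩ := Submodule.mem_span_singleton.mp
    ((hf i).map_mul_mul_mem_span (toMatrix_mem_invAlg hb g'.isIntertwining'))
  have hc' := congrArg (Matrix.toLin b b) hc
  rw [map_smul, Matrix.toLin_mul b b b, Matrix.toLin_mul b b b, Matrix.toLin_toMatrix] at hc'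
  exact ⟨c, fun v => (LinearMap.congr_fun hc' v).symm⟩

end Representation

end WordMatrix

namespace SymSeq

open Finset

variable (k : Type u₁) [Field k] [CharZero k] (W : Type u₁) [AddCommGroup W] [Module k W]
  [Module.Finite k W]

theorem height_rep_tensorAlg (m : ℕ) :
    Order.height (⊤ : Subrepresentation (rep (tensorAlg k W) m)) =
      #{A ∈ WordMatrix.cntSet m (Module.finrank k W) | ∀ i j, A j i = A i j} := by
  let b : Module.Basis (Fin m → Fin (Module.finrank k W)) k (PiTensorProduct k fun _ : Fin m => W) :=
    Basis.piTensorProduct fun _ => Module.finBasis k W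
  have hb : ∀ (σ : Equiv.Perm (Fin m)) x, perm W σ (b x) = b (x ∘ σ.symm) := fun σ x => by
    simp only [b]
    rw [Basis.piTensorProduct_apply, Basis.piTensorProduct_apply]
    exact perm_tprod W σ _
  exact WordMatrix.height_top_eq_card (ρ := rep (tensorAlg k W) m) (b := b) hb

end SymSeq

/-! ### Counting symmetric matrices of natural numbers -/

namespace WordMatrix

open Finset

variable {m d : ℕ}

theorem sum_cnt (x y : Fin m → Fin d) : ∑ i, ∑ j, cnt x y i j = m := by
  simp only [← wt_eq_sum_cnt_left]
  unfold wt
  rw [← card_eq_sum_card_fiberwise (by simp), card_univ, Fintype.card_fin]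

theorem mem_cntSet_iff {A : Fin d → Fin d → ℕ} : A ∈ cntSet m d ↔ ∑ i, ∑ j, A i j = m := by
  constructor
  · intro h
    obtain ⟨⟨x, y⟩, -, rfl⟩ := mem_image.mp h
    exact sum_cnt x y
  · rintro rfl
    -- The positions are labelled so that each pair `(i, j)` appears exactly `A i j` times; the two
    -- coordinates of the labels are the required words.
    have e : Fin (∑ i, ∑ j, A i j) ≃ Σ p : Fin d × Fin d, Fin (A p.1 p.2) :=
      (Fintype.equivFinOfCardEq (by
        rw [Fintype.card_sigma, Fintype.sum_prod_type]
        simp)).symm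
    refine mem_image.mpr ⟨(fun p => (e p).1.1, fun p => (e p).1.2), mem_univ _, ?_⟩
    funext i j
    unfold cnt
    have h : #{s : Σ p : Fin d × Fin d, Fin (A p.1 p.2) | s.1.1 = i ∧ s.1.2 = j} = A i j := by
      rw [← Fintype.card_fin (A i j), ← card_univ]
      symm
      refine card_bij (fun a _ => ⟨(i, j), a⟩) (by simp) ?_ ?_
      · intro a _ b _ h
        simpa using h
      · rintro ⟨⟨i', j'⟩, a⟩ h
        simp only [mem_filter, mem_univ, true_and] at h
        obtain ⟨rfl, rfl⟩ := h
        exact ⟨a, mem_univ _, rfl⟩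
    rw [← h]
    exact card_bij (fun p _ => e p) (by simp) (by simp)
      fun s hs => ⟨e.symm s, by simpa using hs, by simp⟩

variable (m d) in
/-- The symmetric matrices that count the pairs of letters of two words. -/
def symCntSet : Finset (Fin d → Fin d → ℕ) := {A ∈ cntSet m d | ∀ i j, A j i = A i j}

theorem mem_symCntSet_iff {A : Fin d → Fin d → ℕ} :
    A ∈ symCntSet m d ↔ ∑ i, ∑ j, A i j = m ∧ ∀ i j, A j i = A i j := by
  rw [symCntSet, mem_filter, mem_cntSet_iff]

/-- A symmetric matrix is determined by its values on unordered pairs of letters, each at most `n`,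
and there are `(d + 1).choose 2` such pairs. -/
theorem sum_card_symCntSet_le (n d : ℕ) :
    ∑ m ∈ range (n + 1), #(symCntSet m d) ≤ (n + 1) ^ (d + 1).choose 2 := by
  rw [← card_sigma]
  have h : #(Fintype.piFinset fun _ : Sym2 (Fin d) => range (n + 1)) =
      (n + 1) ^ (d + 1).choose 2 := by
    rw [Fintype.card_piFinset, prod_const, card_range, card_univ, Sym2.card, Fintype.card_fin]
  rw [← h]
  refine card_le_card_of_injOn
    (fun p s => p.2 (Quot.out s).1 (Quot.out s).2) ?_ ?_
  · rintro ⟨m, A⟩ hA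
    simp only [coe_sigma, Set.mem_sigma_iff, mem_coe, mem_range, mem_symCntSet_iff] at hA
    simp only [mem_coe, Fintype.mem_piFinset, mem_range]
    intro s
    have h₁ := single_le_sum (f := fun j => A (Quot.out s).1 j) (fun _ _ => Nat.zero_le _)
      (mem_univ (Quot.out s).2)
    have h₂ := single_le_sum (f := fun i => ∑ j, A i j) (fun _ _ => Nat.zero_le _)
      (mem_univ (Quot.out s).1)
    omega
  · rintro ⟨m, A⟩ hA ⟨m', A'⟩ hA' h
    simp only [coe_sigma, Set.mem_sigma_iff, mem_coe, mem_range, mem_symCntSet_iff] at hA hA'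
    have hAA : A = A' := by
      funext i j
      have h₁ := congrFun h s(i, j)
      have h₂ : s((Quot.out s(i, j)).1, (Quot.out s(i, j)).2) = s(i, j) := Quot.out_eq _
      dsimp only at h₁
      rcases Sym2.eq_iff.mp h₂ with ⟨e₁, e₂⟩ | ⟨e₁, e₂⟩
      · rwa [e₁, e₂] at h₁
      · rwa [e₁, e₂, hA.2.2, hA'.2.2] at h₁
    subst hAA
    rw [hA.2.1.symm.trans hA'.2.1]

/-- All `d * d` entries may be chosen up to `n / (d * d + 1)`, symmetrically, without the total
exceeding `n`. The added `1` keeps the divisor positive for `d = 0`. -/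
theorem le_sum_card_symCntSet (n d : ℕ) :
    (n / (d * d + 1) + 1) ^ (d + 1).choose 2 ≤ ∑ m ∈ range (n + 1), #(symCntSet m d) := by
  rw [← card_sigma]
  have h : #(Fintype.piFinset fun _ : Sym2 (Fin d) => range (n / (d * d + 1) + 1)) =
      (n / (d * d + 1) + 1) ^ (d + 1).choose 2 := by
    rw [Fintype.card_piFinset, prod_const, card_range, card_univ, Sym2.card, Fintype.card_fin]
  rw [← h]
  refine card_le_card_of_injOn
    (fun u => ⟨∑ i, ∑ j, u s(i, j), fun i j => u s(i, j)⟩) ?_ ?_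
  · intro u hu
    simp only [mem_coe, Fintype.mem_piFinset, mem_range] at hu
    simp only [coe_sigma, Set.mem_sigma_iff, mem_coe, mem_range, mem_symCntSet_iff, true_and]
    refine ⟨?_, fun i j => by rw [Sym2.eq_swap]⟩
    have h₁ : ∑ i : Fin d, ∑ j : Fin d, u s(i, j) ≤
        ∑ _i : Fin d, ∑ _j : Fin d, n / (d * d + 1) :=
      sum_le_sum fun i _ => sum_le_sum fun j _ => Nat.lt_succ_iff.mp (hu s(i, j))
    simp only [sum_const, card_univ, Fintype.card_fin, smul_eq_mul, ← mul_assoc] at h₁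
    have h₂ := Nat.div_mul_le_self n (d * d + 1)
    nlinarith
  · intro u _ u' _ h
    funext s
    induction s with
    | _ i j =>
      have h₁ := (Sigma.mk.inj_iff.mp h).2
      exact congrFun (congrFun (eq_of_heq h₁) i) j

end WordMatrix

/-! ### The growth of the tensor algebra, and the theorem -/

namespace SymSeq

open Finset WordMatrix

variable (k : Type u₁) [Field k] [CharZero k] (W : Type u₁) [AddCommGroup W] [Module k W]
  [Module.Finite k W]

theorem height_rep_tensorAlg_ne_top (m : ℕ) :
    Order.height (⊤ : Subrepresentation (rep (tensorAlg k W) m)) ≠ ⊤ := by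
  rw [height_rep_tensorAlg]
  exact ENat.natCast_ne_top _

theorem growth_degOne_eq_sum_card (n : ℕ) : growth (degOne k W) n =
    ((∑ m ∈ range (n + 1), #(symCntSet m (Module.finrank k W)) : ℕ) : ℕ∞) := by
  rw [growth_degOne k W (height_rep_tensorAlg_ne_top k W), Nat.cast_sum]
  exact sum_congr rfl fun m _ => height_rep_tensorAlg k W m

theorem isLeast_growthExponents_degOne : IsLeast (growthExponents (degOne k W))
    (((Module.finrank k W + 1).choose 2 : ℕ) : ℝ) := by
  set d := Module.finrank k W with hd
  set D := (d + 1).choose 2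
  have hiff : ∀ (n : ℕ) (x : ℝ), 0 ≤ x → ((growth (degOne k W) n : ENNReal) ≤ ENNReal.ofReal x ↔
      ((∑ m ∈ range (n + 1), #(symCntSet m d) : ℕ) : ℝ) ≤ x) := fun n x hx => by
    rw [growth_degOne_eq_sum_card, ← hd, ENat.toENNReal_coe, ← ENNReal.ofReal_natCast,
      ENNReal.ofReal_le_ofReal_iff hx]
  constructor
  -- The constant comes from `n + 1 ≤ 2 * n` for `n ≥ 1`.
  · refine ⟨2 ^ D, fun n hn => ?_⟩
    rw [hiff n _ (by positivity), Real.rpow_natCast, ← mul_pow]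
    have h₁ : ((∑ m ∈ range (n + 1), #(symCntSet m d) : ℕ) : ℝ) ≤ ((n : ℝ) + 1) ^ D := by
      exact_mod_cast sum_card_symCntSet_le n d
    refine h₁.trans (pow_le_pow_left₀ (by positivity) ?_ _)
    have : (1 : ℝ) ≤ n := by exact_mod_cast hn
    linarith
  · rintro r ⟨c, hc⟩
    by_contra! hr
    -- An exponent `r < D` would bound `n ^ (D - r)`, which tends to infinity. The constant `c` is
    -- replaced by `|c|` since `hiff` needs a nonnegative bound.
    have hbound : ∀ n : ℕ, 1 ≤ n → (n : ℝ) ^ ((D : ℝ) - r) ≤ |c| * ((d * d + 1 : ℕ) : ℝ) ^ D := by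
      intro n hn
      have hn0 : (0 : ℝ) < n := by exact_mod_cast hn
      have h₁ := (hc n hn).trans (ENNReal.ofReal_le_ofReal
        (mul_le_mul_of_nonneg_right (le_abs_self c) (by positivity)))
      rw [hiff n _ (by positivity)] at h₁
      have h₂ : ((n / (d * d + 1) + 1 : ℕ) : ℝ) ^ D ≤
          ((∑ m ∈ range (n + 1), #(symCntSet m d) : ℕ) : ℝ) := by
        exact_mod_cast le_sum_card_symCntSet n d
      have h₃ : (n : ℝ) ≤ ((d * d + 1 : ℕ) : ℝ) * ((n / (d * d + 1) + 1 : ℕ) : ℝ) := by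
        exact_mod_cast (Nat.lt_mul_div_succ n (Nat.succ_pos (d * d))).le
      have h₄ := pow_le_pow_left₀ hn0.le h₃ D
      rw [mul_pow] at h₄
      rw [Real.rpow_sub hn0, Real.rpow_natCast, div_le_iff₀ (by positivity)]
      calc (n : ℝ) ^ D ≤ _ := h₄
        _ ≤ ((d * d + 1 : ℕ) : ℝ) ^ D * (|c| * (n : ℝ) ^ r) := by
          gcongr
          exact h₂.trans h₁
        _ = _ := by ring
    have ht := (tendsto_rpow_atTop (sub_pos.mpr hr)).comp tendsto_natCast_atTop_atTop
    obtain ⟨n, hn, hn'⟩ := ((ht.eventually_gt_atTop (|c| * ((d * d + 1 : ℕ) : ℝ) ^ D)).and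
      (Filter.eventually_ge_atTop 1)).exists
    exact absurd hn (not_lt.mpr (hbound n hn'))

end SymSeq

theorem mainTheorem7 :
    (∀ (k : Type u₂) [Field k] (C : Type u₁) [Category.{v₁} C] [Abelian C] [Linear k C]
        [IsGrothendieckAbelian.{w} C] [MonoidalCategory C] [SymmetricCategory C]
        [MonoidalPreadditive C] [MonoidalLinear k C]
        [∀ X : C, (tensorLeft X).PreservesEpimorphisms]
        (A : C) [MonObj A] [IsCommMonObj A] (V W : Subobject A),
        IsFiniteLengthGenerating V → IsFiniteLengthGenerating W →
          growthExponents V = growthExponents W ∧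
          gkDimWrt V = gkDimWrt W ∧
          gkDim A = gkDimWrt V) ∧
    (∀ (k : Type u₂) [Field k] [CharZero k] (W : Type u₂) [AddCommGroup W] [Module k W]
        [Module.Finite k W],
        (∃ V : Subobject (SymSeq.tensorAlg k W), IsFiniteLengthGenerating V) ∧
        (∀ V : Subobject (SymSeq.tensorAlg k W), IsFiniteLengthGenerating V →
          IsLeast (growthExponents V) (((Module.finrank k W + 1).choose 2 : ℕ) : ℝ)) ∧
        gkDim (SymSeq.tensorAlg k W) =
          ((((Module.finrank k W + 1).choose 2 : ℕ) : ℝ) : EReal)) := by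
  refine ⟨fun k _ C _ _ _ _ _ _ _ _ _ A _ _ V W hV hW =>
    ⟨growthExponents_eq.{w} V W hV hW, gkDimWrt_eq.{w} V W hV hW, gkDim_eq_gkDimWrt.{w} V hV⟩,
    fun k _ _ W _ _ _ => ?_⟩
  have hgen := SymSeq.isFiniteLengthGenerating_degOne k W (SymSeq.height_rep_tensorAlg_ne_top k W)
  have hleast := SymSeq.isLeast_growthExponents_degOne k W
  refine ⟨⟨_, hgen⟩, fun V hV => ?_, ?_⟩
  · rw [growthExponents_eq.{u₂} V _ hV hgen]
    exact hleast
  · rw [gkDim_eq_gkDimWrt.{u₂} _ hgen]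
    exact le_antisymm (iInf₂_le _ hleast.1)
      (le_iInf₂ fun r hr => EReal.coe_le_coe_iff.mpr (hleast.2 hr))
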